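/- There is a universal constant $C<\infty$ with the following property. Let $\tilde\Omega\subset\mathbb{R}^2$ be a bounded open set, let $t>0$, and put $\tilde\Omega_t:=\tilde\Omega\times[0,t]\subset\mathbb{R}^3$. Let $M\in L^2(\mathbb{R}^3;\mathbb{R}^3)$ be such that $M\in H^1(\tilde\Omega_t;\mathbb{R}^3)$ (that is, $M$ is $H^1$ in the open film $\tilde\Omega\times(0,t)$), $|M|=1$ a.e. in $\tilde\Omega_t$, and $M=0$ a.e. outside $\tilde\Omega_t$. Let $$\overline M(x,x_3):=\Big(\frac1t\int_0^t M(x,z)\,dz\Big)\chi_{[0,t]}(x_3),\qquad (x,x_3)\in\mathbb{R}^2\times\mathbb{R},$$ be its thickness average. For a vector field $N$ on $\mathbb{R}^3$, the stray field of $N$ is $\mathcal H[N]:=-\nabla\Phi$, where $\Phi\in H^1(\mathbb{R}^3)$ is the weak solution of $\Delta\Phi=\operatorname{div}N$ in $\mathbb{R}^3$. Then the stray fields $\mathcal H[M]$ and $\mathcal H[\overline M]$ exist, and $$\bigg|\int_{\mathbb{R}^3}|\mathcal H[M]|^2-\int_{\mathbb{R}^3}|\mathcal H[\overline M]|^2\bigg|\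 \le\ C\Big(t\,\big|B_t(\partial\tilde\Omega)\cap\tilde\Omega\big|+t^2\int_{\tilde\Omega_t}|\nabla M|^2\Big),$$ where $B_t(\partial\tilde\Omega):=\{x\in\mathbb{R}^2:\operatorname{dist}(x,\partial\tilde\Omega)<t\}$, $|\cdot|$ of a planar set is its Lebesgue measure, and $|\nabla M|^2=\sum_{i,j}|\partial_jM_i|^2$. -/

import Mathlib

open MeasureTheory Set Topology
open scoped ContDiff RealInnerProductSpace

noncomputable section

/-- The Euclidean plane `ℝ²`. -/
abbrev Plane : Type := EuclideanSpace ℝ (Fin 2)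

/-- Euclidean space `ℝ³ = ℝ² × ℝ`; the third coordinate is the thickness direction. -/
abbrev Space : Type := EuclideanSpace ℝ (Fin 3)

/-- The in-plane part `x'` of a point `(x', x₃)`. -/
def inPlane (p : Space) : Plane := !₂[p 0, p 1]

/-- The point obtained from `(x', x₃)` by replacing the height `x₃` by `z`. -/
def withHeight (p : Space) (z : ℝ) : Space := !₂[p 0, p 1, z]

/-- The product set `Ω × I ⊆ ℝ² × ℝ = ℝ³`. -/
def slab (Ω : Set Plane) (I : Set ℝ) : Set Space := {p | inPlane p ∈ Ω ∧ p 2 ∈ I}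

/-- Smooth real-valued functions with compact support inside `U`. -/
structure IsTestFunction (U : Set Space) (φ : Space → ℝ) : Prop where
  smooth : ContDiff ℝ ∞ φ
  compact : HasCompactSupport φ
  support : tsupport φ ⊆ U

/-- `G` is the weak (distributional) gradient of the scalar function `f` on the open set `U`. -/
structure HasWeakGradientOn (U : Set Space) (f : Space → ℝ) (G : Space → Space) : Prop where
  locInt : LocallyIntegrableOn f U volume
  locInt_grad : LocallyIntegrableOn G U volume
  integral_eq : ∀ φ : Space → ℝ, IsTestFunction U φ → ∀ j : Fin 3,
    ∫ x in U, f x * (gradient φ x) j = - ∫ x in U, (G x) j * φ x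

/-- `G i` is the weak gradient on `U` of the `i`-th component of the vector field `M`,
so that `G i x j = ∂ⱼ Mᵢ (x)`. -/
def HasWeakJacobianOn (U : Set Space) (M : Space → Space) (G : Fin 3 → Space → Space) : Prop :=
  ∀ i : Fin 3, HasWeakGradientOn U (fun x => M x i) (G i)

/-- The vector-valued Sobolev space `H¹(U; ℝ³)`. -/
def MemH1On (U : Set Space) (M : Space → Space) : Prop :=
  MemLp M 2 (volume.restrict U) ∧
    ∃ G : Fin 3 → Space → Space, HasWeakJacobianOn U M G ∧
      ∀ i, MemLp (G i) 2 (volume.restrict U)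

/-- Admissible magnetizations of the film `Ω × [0,t]`: fields in `L²(ℝ³; ℝ³)` that are `H¹` in the
film, of unit length in the film and zero outside (almost everywhere). -/
structure Admissible (Ω : Set Plane) (t : ℝ) (M : Space → Space) : Prop where
  memLp : MemLp M 2 volume
  memH1 : MemH1On (slab Ω (Ioo 0 t)) M
  norm_eq_one : ∀ᵐ x, x ∈ slab Ω (Icc 0 t) → ‖M x‖ = 1
  eq_zero : ∀ᵐ x, x ∉ slab Ω (Icc 0 t) → M x = 0

/-- The thickness average
`M̄(x', x₃) = (t⁻¹ ∫₀ᵗ M(x', z) dz) χ_{[0,t]}(x₃)`. -/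
def thicknessAverage (t : ℝ) (M : Space → Space) (p : Space) : Space :=
  (Icc (0 : ℝ) t).indicator (fun _ => t⁻¹ • ∫ z in Icc (0 : ℝ) t, M (withHeight p z)) (p 2)

/-- `Φ ∈ H¹(ℝ³)`, with weak gradient `G`, is a weak solution of `ΔΦ = div M` in `ℝ³`. -/
structure IsPotential (M : Space → Space) (Φ : Space → ℝ) (G : Space → Space) : Prop where
  memLp : MemLp Φ 2 volume
  weakGradient : HasWeakGradientOn univ Φ G
  memLp_grad : MemLp G 2 volume
  weak_eq : ∀ φ : Space → ℝ, IsTestFunction univ φ →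
    ∫ x, ⟪G x, gradient φ x⟫ = ∫ x, ⟪M x, gradient φ x⟫

/-- `H` is the stray field `ℋ(M) = -∇Φ` of `M`, where `Φ ∈ H¹(ℝ³)` solves `ΔΦ = div M`. -/
def IsStrayField (M H : Space → Space) : Prop :=
  ∃ (Φ : Space → ℝ) (G : Space → Space), IsPotential M Φ G ∧ H =ᵐ[volume] fun x => -G x

end

/-! By Plancherel the energy of the stray field of `M` is the integral of |ξ·M̂|²/|ξ|², whichever
potential is chosen (`IsStrayField.integral_norm_sq`). The field in the film is therefore split
before transforming: M = N + R + D, where D = M − M̄ is the fluctuation about the thickness average,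
N = η M̄ and R = (1 − η) M̄, with η a cutoff in the plane that vanishes near ∂Ω, equals 1 at
distance at least t from it, and has gradient of order 1/t.

Expanding the square gives the energy difference as a D–D term, a D–R term and a D–N term. The
projection ξ⊗ξ/|ξ|² is a contraction, so the first two are controlled by ∫|D|² and ∫|R|². The
Poincaré inequality in the thickness direction gives ∫|D|² ≤ t²∫|∂₃M|², and R is bounded by 1 and
lives in the boundary layer, so ∫|R|² is of order t times the area of that layer.

The D–N term is the delicate one: Cauchy–Schwarz would lose, because N is of order one. Two facts
save it. First, D has zero vertical mean, so it is ∂₃F on all of ℝ³, where F, the vertical primitive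
extended by zero, has no jump at either face. Second, once the e₃⊗e₃ part is removed, ∂₃F meets N
through ξ⊗ξ/|ξ|² only by way of horizontal derivatives of N: the factor ξ₃ from D can be traded for
ξ₁ or ξ₂ on N (`norm_projection_sub_vertical_le`). The e₃⊗e₃ part is ∫D₃N₃, which is zero because N
does not depend on the height inside the film.

What remains is at most t⁻²∫|F|² + t²∫|∇'N|² up to constants. The first is at most t²∫|∂₃M|², since
a primitive over a length t costs a further factor t. The second is at most t²∫|∇M|² plus t²·t⁻²
times the volume of the film over the boundary layer. The cutoff makes N weakly differentiable in
horizontal directions across the lateral boundary of the film; the jumps at the two faces do not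
affect horizontal derivatives.

Existence of the stray fields follows from solving for the potential in Fourier space. The fields
are also in L¹, so their transforms are bounded, and |ξ|⁻² is integrable near the origin of ℝ³. -/

noncomputable section

open scoped FourierTransform SchwartzMap LineDeriv

/-! ### The L² Fourier transform and weak derivatives -/

/-- The `j`-th standard basis vector of `ℝ³`. -/
abbrev basisVec (j : Fin 3) : Space := EuclideanSpace.single j (1 : ℝ)

/-- Complex-valued square integrable functions on `ℝ³`. -/
abbrev L2C : Type := Lp (α := Space) ℂ 2 (volume : Measure Space)

/-- The L² transform agrees with the transform of tempered distributions, which is defined by this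
duality. It allows identities for L² transforms to be checked against Schwartz functions. -/
theorem integral_fourier_mul (f : L2C) (v : 𝓢(Space, ℂ)) :
    ∫ x, (𝓕 v : 𝓢(Space, ℂ)) x * f x = ∫ x, v x * (𝓕 f : L2C) x := by
  have h := congrArg (fun T : 𝓢'(Space, ℂ) => T v) (Lp.fourier_toTemperedDistribution_eq f)
  simpa [TemperedDistribution.fourier_apply] using h

theorem lineDeriv_fourier_apply (v : 𝓢(Space, ℂ)) (j : Fin 3) :
    ∂_{basisVec j} (𝓕 v) =
      𝓕 (-(2 * Real.pi * Complex.I) • SchwartzMap.smulLeftCLM ℂ (fun ξ : Space => ξ j) v) := by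
  have := SchwartzMap.lineDerivOp_fourier_eq v (basisVec j)
  simpa [EuclideanSpace.inner_single_right] using this

theorem hasTemperateGrowth_coord (j : Fin 3) :
    Function.HasTemperateGrowth (fun ξ : Space => ξ j) := by
  exact (EuclideanSpace.proj j : Space →L[ℝ] ℝ).hasTemperateGrowth

theorem SchwartzMap.integrable_mul_L2C (v : 𝓢(Space, ℂ)) (f : L2C) :
    Integrable (fun x => v x * f x) :=
  (v.memLp 2).integrable_mul (Lp.memLp f)

theorem integral_lineDeriv_fourier_mul (f : L2C) (v : 𝓢(Space, ℂ)) (j : Fin 3) :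
    ∫ x, (∂_{basisVec j} (𝓕 v) : 𝓢(Space, ℂ)) x * f x =
      -∫ ξ, v ξ * (2 * Real.pi * Complex.I * ξ j * (𝓕 f : L2C) ξ) := by
  rw [lineDeriv_fourier_apply, integral_fourier_mul, ← integral_neg]
  congr 1 with ξ
  rw [smul_apply, SchwartzMap.smulLeftCLM_apply_apply (hasTemperateGrowth_coord j)]
  simp
  ring

theorem integrable_schwartz_mul_coord_mul (f : L2C) (v : 𝓢(Space, ℂ)) (j : Fin 3) :
    Integrable (fun ξ => v ξ * (2 * Real.pi * Complex.I * ξ j * f ξ)) := by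
  have := ((SchwartzMap.smulLeftCLM ℂ (fun ξ : Space => ξ j) v).integrable_mul_L2C f).const_mul
    (2 * Real.pi * Complex.I)
  refine this.congr (Filter.Eventually.of_forall fun ξ => ?_)
  simp only [SchwartzMap.smulLeftCLM_apply_apply (hasTemperateGrowth_coord j), Complex.real_smul]
  ring

theorem L2C.locallyIntegrable (f : L2C) : LocallyIntegrable (fun x => f x) :=
  (Lp.memLp f).locallyIntegrable (by norm_num)

/-- The Fourier symbol of a divergence: `g = div f` weakly iff `ĝ = ∑ 2πi ξⱼ f̂ⱼ`. -/
theorem divergence_iff_fourier (f : Fin 3 → L2C) (g : L2C) :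
    (∀ u : 𝓢(Space, ℂ), ∑ j, ∫ x, (∂_{basisVec j} u : 𝓢(Space, ℂ)) x * f j x =
        -∫ x, u x * g x) ↔
      (fun ξ => (𝓕 g : L2C) ξ) =ᵐ[volume]
        fun ξ => ∑ j, 2 * Real.pi * Complex.I * ξ j * (𝓕 (f j) : L2C) ξ := by
  have key : ∀ v : 𝓢(Space, ℂ),
      (∑ j, ∫ x, (∂_{basisVec j} (𝓕 v) : 𝓢(Space, ℂ)) x * f j x =
        -∫ x, (𝓕 v : 𝓢(Space, ℂ)) x * g x) ↔
      ∫ ξ, v ξ * (∑ j, 2 * Real.pi * Complex.I * ξ j * (𝓕 (f j) : L2C) ξ) =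
        ∫ ξ, v ξ * (𝓕 g : L2C) ξ := by
    intro v
    simp only [integral_lineDeriv_fourier_mul, integral_fourier_mul, Finset.mul_sum]
    rw [integral_finsetSum _ fun j _ => integrable_schwartz_mul_coord_mul _ v j,
      Finset.sum_neg_distrib, neg_inj]
  constructor
  · intro h
    have hloc : LocallyIntegrable (fun ξ : Space =>
        ∑ j, 2 * Real.pi * Complex.I * ξ j * (𝓕 (f j) : L2C) ξ) := by
      refine locallyIntegrable_finsetSum _ fun j _ => ?_
      exact (L2C.locallyIntegrable (𝓕 (f j))).continuous_mul
        (g := fun ξ : Space => 2 * Real.pi * Complex.I * ((ξ j : ℝ) : ℂ)) (by fun_prop)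
    -- The symbol side need not be square integrable, only locally integrable, so the two sides are
    -- compared by testing against smooth compactly supported functions.
    refine ae_eq_of_integral_contDiff_smul_eq (L2C.locallyIntegrable _) hloc fun φ hφ hc => ?_
    have hc' : HasCompactSupport (fun x => (φ x : ℂ)) := hc.comp_left (g := Complex.ofReal) rfl
    have hφ' : ContDiff ℝ ∞ (fun x => (φ x : ℂ)) := Complex.ofRealCLM.contDiff.comp hφ
    have := (key (hc'.toSchwartzMap hφ')).1 (h _)
    simpa using this.symm
  · intro h u
    have := (key (𝓕⁻ u)).2 (integral_congr_ae ?_)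
    · simpa using this
    · filter_upwards [h] with ξ hξ
      rw [hξ]

theorem gradient_coord (φ : Space → ℝ) (x : Space) (j : Fin 3) :
    (gradient φ x) j = fderiv ℝ φ x (basisVec j) := by
  rw [← inner_gradient_left, EuclideanSpace.inner_single_right]
  simp

theorem IsTestFunction.memLp_fderiv {φ : Space → ℝ} {U : Set Space} (h : IsTestFunction U φ)
    (v : Space) : MemLp (fun x => fderiv ℝ φ x v) 2 volume := by
  have hc : Continuous fun x => fderiv ℝ φ x v :=
    (h.smooth.continuous_fderiv (by simp)).clm_apply continuous_const
  exact hc.memLp_of_hasCompactSupport (h.compact.fderiv_apply ℝ v)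

theorem IsTestFunction.memLp {φ : Space → ℝ} {U : Set Space} (h : IsTestFunction U φ) :
    MemLp φ 2 volume :=
  h.smooth.continuous.memLp_of_hasCompactSupport h.compact

/-- `g` is the distributional divergence of `f` on `ℝ³`. -/
def HasWeakDivergence (f : Fin 3 → Space → ℝ) (g : Space → ℝ) : Prop :=
  ∀ φ : Space → ℝ, IsTestFunction univ φ →
    ∑ j, ∫ x, fderiv ℝ φ x (basisVec j) * f j x = -∫ x, φ x * g x

section Complexification

variable {f : Fin 3 → Space → ℝ} {g : Space → ℝ} (hf : ∀ j, MemLp (f j) 2 volume)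
  (hg : MemLp g 2 volume)

include hf hg

/-- The real and imaginary parts of a complex test function are real test functions. The argument is
run once for a real-linear functional `L` that commutes with multiplication by reals. -/
theorem HasWeakDivergence.integral_complex (h : HasWeakDivergence f g) {w : Space → ℂ}
    (hw : ContDiff ℝ ∞ w) (hc : HasCompactSupport w) :
    ∑ j, ∫ x, fderiv ℝ w x (basisVec j) * (f j x : ℂ) = -∫ x, w x * (g x : ℂ) := by
  have hd : ∀ x, DifferentiableAt ℝ w x := fun x => hw.differentiable (by simp) x
  have hi : ∀ j, Integrable fun x => fderiv ℝ w x (basisVec j) * (f j x : ℂ) := fun j => by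
    have hcont : Continuous fun x => fderiv ℝ w x (basisVec j) :=
      (hw.continuous_fderiv (by simp)).clm_apply continuous_const
    exact (hcont.memLp_of_hasCompactSupport (p := 2) (hc.fderiv_apply ℝ _)).integrable_mul
      (hf j).ofReal
  have hi' : Integrable fun x => w x * (g x : ℂ) :=
    (hw.continuous.memLp_of_hasCompactSupport (p := 2) hc).integrable_mul hg.ofReal
  have main : ∀ L : ℂ →L[ℝ] ℝ, (∀ (a : ℂ) (r : ℝ), L (a * r) = L a * r) →
      L (∑ j, ∫ x, fderiv ℝ w x (basisVec j) * (f j x : ℂ)) = L (-∫ x, w x * (g x : ℂ)) := by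
    intro L hL
    have ht : IsTestFunction univ fun x => L (w x) :=
      ⟨L.contDiff.comp hw, hc.comp_left (g := L) L.map_zero, subset_univ _⟩
    have := h _ ht
    rw [map_sum, map_neg, ← L.integral_comp_comm hi']
    simp_rw [← L.integral_comp_comm (hi _), hL]
    rw [← this]
    refine Finset.sum_congr rfl fun j _ => integral_congr_ae (.of_forall fun x => ?_)
    have : HasFDerivAt (fun x => L (w x)) (L.comp (fderiv ℝ w x)) x :=
      L.hasFDerivAt.comp x (hd x).hasFDerivAt
    simp [this.fderiv]
  refine Complex.ext ?_ ?_
  · exact main Complex.reCLM (by simp)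
  · exact main Complex.imCLM (by simp)

/-- Multiplying by dilated cutoffs reduces a Schwartz function to compactly supported ones. The
derivatives of the cutoffs stay uniformly bounded and vanish eventually at each point, so dominated
convergence applies. -/
theorem HasWeakDivergence.integral_schwartz (h : HasWeakDivergence f g) (u : 𝓢(Space, ℂ)) :
    ∑ j, ∫ x, (∂_{basisVec j} u : 𝓢(Space, ℂ)) x * (f j x : ℂ) =
      -∫ x, u x * (g x : ℂ) := by
  let χ : ContDiffBump (0 : Space) := ⟨1, 2, one_pos, one_lt_two⟩
  have hχd : ContDiff ℝ ∞ (χ : Space → ℝ) := χ.contDiff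
  obtain ⟨K, hK⟩ : ∃ K, ∀ x, ‖fderiv ℝ χ x‖ ≤ K :=
    (χ.hasCompactSupport.fderiv ℝ).exists_bound_of_continuous (hχd.continuous_fderiv (by simp))
  let c : ℕ → ℝ := fun n => ((n : ℝ) + 1)⁻¹
  have hc0 : ∀ n, 0 < c n := fun n => by positivity
  have hc1 : ∀ n, c n ≤ 1 := fun n => inv_le_one_of_one_le₀ (by linarith [n.cast_nonneg (α := ℝ)])
  let X : ℕ → Space → ℝ := fun n x => χ (c n • x)
  have hX : ∀ n, ContDiff ℝ ∞ (X n) := fun n => hχd.comp (contDiff_const_smul (c n))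
  have hXc : ∀ n, HasCompactSupport (X n) := fun n =>
    χ.hasCompactSupport.comp_smul (hc0 n).ne'
  have hXn : ∀ n x, |X n x| ≤ 1 := fun n x => by
    rw [abs_of_nonneg χ.nonneg]; exact χ.le_one
  have hX' : ∀ n x, HasFDerivAt (X n) (c n • fderiv ℝ χ (c n • x)) x := fun n x => by
    have h1 : HasFDerivAt (fun y : Space => c n • y) (c n • ContinuousLinearMap.id ℝ Space) x :=
      (hasFDerivAt_id x).const_smul (c n)
    have h2 := ((hχd.differentiable (by simp)) (c n • x)).hasFDerivAt.comp x h1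
    simpa [Function.comp_def] using h2
  have hX'n : ∀ n x j, |fderiv ℝ (X n) x (basisVec j)| ≤ K := fun n x j => by
    rw [(hX' n x).fderiv, ← Real.norm_eq_abs]
    refine (ContinuousLinearMap.le_opNorm _ _).trans ?_
    rw [PiLp.norm_single, norm_smul, norm_one, mul_one, Real.norm_of_nonneg (hc0 n).le]
    exact (mul_le_of_le_one_left (norm_nonneg _) (hc1 n)).trans (hK _)
  have hev : ∀ x : Space, ∀ᶠ n in Filter.atTop, ‖c n • x‖ < 1 := fun x => by
    have : Filter.Tendsto (fun n => ‖c n • x‖) Filter.atTop (𝓝 ‖(0 : ℝ) • x‖) :=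
      ((tendsto_inv_atTop_zero.comp (Filter.tendsto_atTop_add_const_right _ 1
        tendsto_natCast_atTop_atTop)).smul_const x).norm
    exact this.eventually_lt_const (by simp)
  have hX1 : ∀ x, ∀ᶠ n in Filter.atTop, X n x = 1 := fun x => by
    filter_upwards [hev x] with n hn
    exact χ.one_of_mem_closedBall (mem_closedBall_zero_iff.2 hn.le)
  have hX0 : ∀ x, ∀ᶠ n in Filter.atTop, fderiv ℝ (X n) x = 0 := fun x => by
    filter_upwards [hev x] with n hn
    have : (χ : Space → ℝ) =ᶠ[𝓝 (c n • x)] fun _ => 1 :=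
      χ.eventuallyEq_one_of_mem_ball (mem_ball_zero_iff.2 hn)
    rw [(hX' n x).fderiv, this.fderiv_eq]
    simp
  have hud : ContDiff ℝ ∞ (u : Space → ℂ) := u.smooth ⊤
  let w : ℕ → Space → ℂ := fun n x => X n x • u x
  have hw : ∀ n, ContDiff ℝ ∞ (w n) := fun n => (hX n).smul hud
  have hwc : ∀ n, HasCompactSupport (w n) := fun n => (hXc n).smul_right
  have hw' : ∀ n x j, fderiv ℝ (w n) x (basisVec j) =
      X n x • (∂_{basisVec j} u : 𝓢(Space, ℂ)) x + fderiv ℝ (X n) x (basisVec j) • u x := by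
    intro n x j
    have := ((hX n).differentiable (by simp) x).hasFDerivAt.smul
      (hud.differentiable (by simp) x).hasFDerivAt
    rw [show w n = X n • (u : Space → ℂ) from rfl, this.fderiv,
      SchwartzMap.lineDerivOp_apply_eq_fderiv]
    simp
  have key := fun n => h.integral_complex hf hg (hw n) (hwc n)
  have lim1 : ∀ j, Filter.Tendsto (fun n => ∫ x, fderiv ℝ (w n) x (basisVec j) * (f j x : ℂ))
      Filter.atTop (𝓝 (∫ x, (∂_{basisVec j} u : 𝓢(Space, ℂ)) x * (f j x : ℂ))) := fun j => by
    have b1 : Integrable fun x => ‖(∂_{basisVec j} u : 𝓢(Space, ℂ)) x‖ * ‖f j x‖ :=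
      ((∂_{basisVec j} u : 𝓢(Space, ℂ)).memLp 2).norm.integrable_mul (hf j).norm
    have b2 : Integrable fun x => ‖u x‖ * ‖f j x‖ := (u.memLp 2).norm.integrable_mul (hf j).norm
    refine tendsto_integral_of_dominated_convergence
      (fun x => ‖(∂_{basisVec j} u : 𝓢(Space, ℂ)) x‖ * ‖f j x‖ + K * (‖u x‖ * ‖f j x‖))
      (fun n => ?_) (b1.add (b2.const_mul K)) (fun n => .of_forall fun x => ?_)
      (.of_forall fun x => ?_)
    · exact (((hw n).continuous_fderiv (by simp)).clm_apply
        continuous_const).aestronglyMeasurable.mul (hf j).ofReal.aestronglyMeasurable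
    · rw [hw', norm_mul, ← mul_assoc, ← add_mul, Complex.norm_real]
      refine mul_le_mul_of_nonneg_right ((norm_add_le _ _).trans (add_le_add ?_ ?_)) (norm_nonneg _)
      · rw [norm_smul]
        exact mul_le_of_le_one_left (norm_nonneg _) (hXn n x)
      · rw [norm_smul]
        exact mul_le_mul_of_nonneg_right (hX'n n x j) (norm_nonneg _)
    · refine tendsto_const_nhds.congr' ?_
      filter_upwards [hX1 x, hX0 x] with n h1 h2
      rw [hw', h1, h2]
      simp
  have lim2 : Filter.Tendsto (fun n => ∫ x, w n x * (g x : ℂ))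
      Filter.atTop (𝓝 (∫ x, u x * (g x : ℂ))) := by
    have b2 : Integrable fun x => ‖u x‖ * ‖g x‖ := (u.memLp 2).norm.integrable_mul hg.norm
    refine tendsto_integral_of_dominated_convergence (fun x => ‖u x‖ * ‖g x‖)
      (fun n => ?_) b2 (fun n => .of_forall fun x => ?_) (.of_forall fun x => ?_)
    · exact (hw n).continuous.aestronglyMeasurable.mul hg.ofReal.aestronglyMeasurable
    · rw [norm_mul, Complex.norm_real, norm_smul]
      exact mul_le_mul_of_nonneg_right (mul_le_of_le_one_left (norm_nonneg _) (hXn n x))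
        (norm_nonneg _)
    · refine tendsto_const_nhds.congr' ?_
      filter_upwards [hX1 x] with n h1
      simp [w, h1]
  exact tendsto_nhds_unique ((tendsto_finsetSum _ fun j _ => lim1 j).congr key) lim2.neg

end Complexification

/-- A real square integrable function as an element of complex `L²`. -/
def toL2C {f : Space → ℝ} (hf : MemLp f 2 volume) : L2C := (hf.ofReal (K := ℂ)).toLp _

theorem coeFn_toL2C {f : Space → ℝ} (hf : MemLp f 2 volume) :
    ∀ᵐ x, toL2C hf x = (f x : ℂ) :=
  (hf.ofReal (K := ℂ)).coeFn_toLp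

/-- The `L²` Fourier transform of a real square integrable function on `ℝ³`. -/
def hat {f : Space → ℝ} (hf : MemLp f 2 volume) : L2C := 𝓕 (toL2C hf)

/-- Plancherel in polarised form. The left side is real, so only the real part of the product on the
Fourier side survives. -/
theorem integral_mul_eq_hat {f g : Space → ℝ} (hf : MemLp f 2 volume) (hg : MemLp g 2 volume) :
    ∫ x, f x * g x = ∫ ξ, (starRingEnd ℂ (hat hf ξ) * hat hg ξ).re := by
  have h := Lp.inner_fourier_eq (toL2C hf)
    (toL2C hg)
  rw [L2.inner_def, L2.inner_def] at h
  have h1 : ∫ a, inner ℂ (toL2C hf a) (toL2C hg a) =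
      ((∫ x, f x * g x : ℝ) : ℂ) := by
    rw [← integral_complex_ofReal]
    refine integral_congr_ae ?_
    filter_upwards [coeFn_toL2C hf, coeFn_toL2C hg] with x h1 h2
    rw [h1, h2]
    simp [mul_comm]
  rw [h1] at h
  have h2 := congrArg Complex.re h
  rw [Complex.ofReal_re, ← RCLike.re_eq_complex_re, ← integral_re (L2.integrable_inner _ _)] at h2
  rw [← h2]
  refine integral_congr_ae (.of_forall fun x => ?_)
  simp only [RCLike.inner_apply', RCLike.re_eq_complex_re, hat]

theorem integral_sq_eq_hat {f : Space → ℝ} (hf : MemLp f 2 volume) :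
    ∫ x, f x ^ 2 = ∫ ξ, ‖hat hf ξ‖ ^ 2 := by
  simp_rw [pow_two (f _)]
  rw [integral_mul_eq_hat hf hf]
  refine integral_congr_ae (.of_forall fun x => ?_)
  simp only [Complex.conj_mul', ← Complex.ofReal_pow, Complex.ofReal_re]

theorem hat_add {f g : Space → ℝ} (hf : MemLp f 2 volume) (hg : MemLp g 2 volume)
    {h : Space → ℝ} (hh : MemLp h 2 volume) (he : h =ᵐ[volume] fun x => f x + g x) :
    ∀ᵐ ξ, hat hh ξ = hat hf ξ + hat hg ξ := by
  have : (toL2C hh) = (toL2C hf) + (toL2C hg) := by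
    refine Lp.ext ?_
    filter_upwards [he, coeFn_toL2C hf, coeFn_toL2C hg, coeFn_toL2C hh,
      Lp.coeFn_add (toL2C hf) (toL2C hg)] with x hx h1 h2 h3 h4
    rw [h4, Pi.add_apply, h1, h2, h3, hx, Complex.ofReal_add]
  have h2 : hat hh = hat hf + hat hg := by
    rw [hat, this]
    exact FourierTransform.fourier_add (F := L2C) _ _
  rw [h2]
  exact Lp.coeFn_add _ _

theorem HasWeakDivergence.hat_eq {f : Fin 3 → Space → ℝ} {g : Space → ℝ}
    (h : HasWeakDivergence f g) (hf : ∀ j, MemLp (f j) 2 volume) (hg : MemLp g 2 volume) :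
    ∀ᵐ ξ, hat hg ξ = ∑ j, 2 * Real.pi * Complex.I * ξ j * hat (hf j) ξ := by
  refine (divergence_iff_fourier (fun j => toL2C (hf j))
    (toL2C hg)).1 fun u => ?_
  refine Eq.trans (Finset.sum_congr rfl fun j _ => ?_)
    ((h.integral_schwartz hf hg u).trans (congrArg Neg.neg ?_))
  · refine integral_congr_ae ?_
    filter_upwards [coeFn_toL2C (hf j)] with x hx
    rw [hx]
  · refine integral_congr_ae ?_
    filter_upwards [coeFn_toL2C hg] with x hx
    rw [hx]

/-- A weak partial derivative becomes multiplication by `2πi ξⱼ` on the Fourier side. -/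
theorem hat_weakDeriv {f g : Space → ℝ} (hf : MemLp f 2 volume) (hg : MemLp g 2 volume) (j : Fin 3)
    (h : ∀ φ : Space → ℝ, IsTestFunction univ φ →
      ∫ x, fderiv ℝ φ x (basisVec j) * f x = -∫ x, φ x * g x) :
    ∀ᵐ ξ, hat hg ξ = 2 * Real.pi * Complex.I * ξ j * hat hf ξ := by
  -- A single partial derivative is the divergence of the field whose only nonzero component is the
  -- `j`-th.
  have hF : ∀ k, MemLp (fun x => if k = j then f x else 0) 2 volume := fun k => by
    by_cases hk : k = j
    · simpa [hk] using hf
    · simp [hk]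
  have hw : HasWeakDivergence (fun k x => if k = j then f x else 0) g := fun φ hφ => by
    rw [← h φ hφ, Finset.sum_eq_single j] <;> simp +contextual
  have h0 : ∀ᵐ ξ, ∀ k, k ≠ j → hat (hF k) ξ = 0 := by
    refine ae_all_iff.2 fun k => ?_
    by_cases hk : k = j
    · simp [hk]
    have h1 : toL2C (hF k) = 0 := by
      rw [Lp.eq_zero_iff_ae_eq_zero]
      filter_upwards [coeFn_toL2C (hF k)] with x hx
      rw [hx]; simp [hk]
    have h2 : hat (hF k) = 0 := by
      rw [hat, h1]
      exact FourierTransform.fourier_zero (E := L2C)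
    rw [h2]
    filter_upwards [Lp.coeFn_zero ℂ 2 (volume : Measure Space)] with x hx
    intro _
    rw [hx]; rfl
  filter_upwards [hw.hat_eq hF hg, h0] with ξ hξ h0
  rw [hξ, Finset.sum_eq_single j (fun k _ hk => by rw [h0 k hk, mul_zero]) (by simp)]
  congr 3
  simp [hat]

/-! ### The stray-field energy in Fourier space -/

theorem MemLp.coord {M : Space → Space} {μ : Measure Space} (hM : MemLp M 2 μ) (j : Fin 3) :
    MemLp (fun x => M x j) 2 μ :=
  (EuclideanSpace.proj j : Space →L[ℝ] ℝ).comp_memLp' hM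

theorem integrable_mul_of_memLp {X : Type*} [MeasurableSpace X] {μ : Measure X} {f g : X → ℝ}
    (hf : MemLp f 2 μ) (hg : MemLp g 2 μ) : Integrable (fun x => f x * g x) μ :=
  hf.integrable_mul hg

theorem integral_inner_gradient {M : Space → Space} (hM : MemLp M 2 volume) {φ : Space → ℝ}
    (hφ : IsTestFunction univ φ) :
    ∫ x, ⟪M x, gradient φ x⟫ = ∑ j, ∫ x, fderiv ℝ φ x (basisVec j) * M x j := by
  rw [← integral_finsetSum _ fun j _ =>
    integrable_mul_of_memLp (hφ.memLp_fderiv _) (MemLp.coord hM j)]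
  refine integral_congr_ae (.of_forall fun x => ?_)
  simp only [PiLp.inner_apply, gradient_coord]
  simp [mul_comm]

/-- The magnetostatic energy density in Fourier space, `|ξ · v|² / |ξ|²`. -/
def symbolEnergy (ξ : Space) (v : Fin 3 → ℂ) : ℝ := ‖∑ k, (ξ k : ℂ) * v k‖ ^ 2 / ‖ξ‖ ^ 2

theorem norm_sq_eq_sum (ξ : Space) : ‖ξ‖ ^ 2 = ∑ k, ξ k ^ 2 := by
  rw [EuclideanSpace.norm_sq_eq]
  simp

/-- Ĝ is parallel to ξ since G is a gradient, and ξ·Ĝ = ξ·M̂ since G − M is divergence free; hence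
|Ĝ|² = |ξ·M̂|²/|ξ|². The value depends on M alone, so uniqueness of the potential is never required.
-/
theorem IsPotential.integral_norm_sq {M : Space → Space} {Φ : Space → ℝ} {G : Space → Space}
    (h : IsPotential M Φ G) (hM : MemLp M 2 volume) :
    ∫ x, ‖G x‖ ^ 2 = ∫ ξ, symbolEnergy ξ fun k => hat (MemLp.coord hM k) ξ := by
  have hG := h.memLp_grad
  have h1 : ∀ᵐ ξ, ∀ j, hat (MemLp.coord hG j) ξ =
      2 * Real.pi * Complex.I * ξ j * hat h.memLp ξ := by
    refine ae_all_iff.2 fun j => hat_weakDeriv h.memLp (MemLp.coord hG j) j fun φ hφ => ?_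
    have := h.weakGradient.integral_eq φ hφ j
    simp only [Measure.restrict_univ, gradient_coord] at this
    simpa only [mul_comm] using this
  have hdiv : HasWeakDivergence (fun j x => G x j - M x j) (fun _ => 0) := fun φ hφ => by
    have h2 := h.weak_eq φ hφ
    rw [integral_inner_gradient hG hφ, integral_inner_gradient hM hφ, ← sub_eq_zero,
      ← Finset.sum_sub_distrib] at h2
    simp only [mul_zero, integral_zero, neg_zero]
    rw [← h2]
    refine Finset.sum_congr rfl fun j _ => ?_
    rw [← integral_sub (integrable_mul_of_memLp (hφ.memLp_fderiv _) (MemLp.coord hG j))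
      (integrable_mul_of_memLp (hφ.memLp_fderiv _) (MemLp.coord hM j))]
    simp only [mul_sub]
  have hsub : ∀ j, MemLp (fun x => G x j - M x j) 2 volume :=
    fun j => (MemLp.coord hG j).sub (MemLp.coord hM j)
  have h0 : ∀ᵐ ξ, hat (MemLp.zero' (ε := ℝ) (p := 2) (μ := (volume : Measure Space))) ξ = 0 := by
    have hz : toL2C (MemLp.zero' (ε := ℝ) (p := 2) (μ := (volume : Measure Space))) = 0 := by
      rw [Lp.eq_zero_iff_ae_eq_zero]
      filter_upwards [coeFn_toL2C (MemLp.zero' (ε := ℝ) (p := 2) (μ := (volume : Measure Space)))]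
        with x hx
      rw [hx]; simp
    rw [hat, hz, FourierTransform.fourier_zero (E := L2C)]
    exact Lp.coeFn_zero ℂ 2 (volume : Measure Space)
  have h3 : ∀ᵐ ξ, ∀ j, hat (MemLp.coord hG j) ξ = hat (hsub j) ξ + hat (MemLp.coord hM j) ξ :=
    ae_all_iff.2 fun j => hat_add (hsub j) (MemLp.coord hM j) (MemLp.coord hG j)
      (.of_forall fun x => by simp)
  have h4 : ∀ᵐ ξ, ∑ j, (ξ j : ℂ) * hat (MemLp.coord hG j) ξ =
      ∑ j, (ξ j : ℂ) * hat (MemLp.coord hM j) ξ := by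
    filter_upwards [h3, hdiv.hat_eq hsub MemLp.zero', h0] with ξ h3 h5 h0
    rw [h0] at h5
    have h6 : (2 * Real.pi * Complex.I) * ∑ j, (ξ j : ℂ) * hat (hsub j) ξ = 0 := by
      rw [h5, Finset.mul_sum]
      exact Finset.sum_congr rfl fun j _ => by ring
    have h7 := (mul_eq_zero.1 h6).resolve_left Complex.two_pi_I_ne_zero
    simp only [h3, mul_add, Finset.sum_add_distrib, h7, zero_add]
  calc ∫ x, ‖G x‖ ^ 2 = ∫ x, ∑ j, G x j ^ 2 := by simp only [norm_sq_eq_sum]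
    _ = ∑ j, ∫ x, G x j ^ 2 := integral_finsetSum _ fun j _ => (MemLp.coord hG j).integrable_sq
    _ = ∑ j, ∫ ξ, ‖hat (MemLp.coord hG j) ξ‖ ^ 2 := by simp_rw [integral_sq_eq_hat (MemLp.coord hG _)]
    _ = ∫ ξ, ∑ j, ‖hat (MemLp.coord hG j) ξ‖ ^ 2 :=
      (integral_finsetSum _ fun j _ => (Lp.memLp _).norm.integrable_sq).symm
    _ = _ := by
      refine integral_congr_ae ?_
      filter_upwards [h1, h4] with ξ h1 h4
      rw [symbolEnergy, ← h4]
      have hs : ∑ j, (ξ j : ℂ) * hat (MemLp.coord hG j) ξ =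
          ((2 * Real.pi * ‖ξ‖ ^ 2 : ℝ) : ℂ) * (Complex.I * hat h.memLp ξ) := by
        rw [norm_sq_eq_sum]
        push_cast
        rw [Finset.mul_sum, Finset.sum_mul]
        exact Finset.sum_congr rfl fun j _ => by rw [h1]; ring
      have hn : ∀ j, ‖hat (MemLp.coord hG j) ξ‖ ^ 2 =
          ξ j ^ 2 * ((2 * Real.pi) ^ 2 * ‖hat h.memLp ξ‖ ^ 2) := fun j => by
        rw [h1]
        simp only [norm_mul, Complex.norm_real, Complex.norm_I, Complex.norm_ofNat, mul_pow,
          Real.norm_eq_abs, sq_abs]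
        ring
      rw [hs, Finset.sum_congr rfl fun j _ => hn j, ← Finset.sum_mul, ← norm_sq_eq_sum]
      rw [norm_mul, norm_mul, Complex.norm_I, Complex.norm_real, Real.norm_of_nonneg (by positivity)]
      -- At the origin both sides vanish, the left one through division by zero.
      by_cases hξ : ‖ξ‖ = 0
      · simp [hξ]
      · field_simp

theorem IsStrayField.integral_norm_sq {M H : Space → Space} (h : IsStrayField M H)
    (hM : MemLp M 2 volume) :
    ∫ x, ‖H x‖ ^ 2 = ∫ ξ, symbolEnergy ξ fun k => hat (MemLp.coord hM k) ξ := by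
  obtain ⟨Φ, G, hP, hH⟩ := h
  rw [← hP.integral_norm_sq hM]
  refine integral_congr_ae ?_
  filter_upwards [hH] with x hx
  rw [hx, norm_neg]

/-! ### Existence of stray fields -/

/-- The Fourier transform of a function in `L¹ ∩ L²` is bounded by its `L¹` norm. -/
theorem norm_hat_le {f : Space → ℝ} (hf : MemLp f 2 volume) (hi : Integrable f) :
    ∀ᵐ ξ, ‖hat hf ξ‖ ≤ ∫ x, ‖f x‖ := by
  let fc : Space → ℂ := fun x => f x
  have hfc : Integrable fc := hi.ofReal
  have hb : ∀ ξ, ‖𝓕 fc ξ‖ ≤ ∫ x, ‖f x‖ := fun ξ => by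
    refine (VectorFourier.norm_fourierIntegral_le_integral_norm _ _ _ _ _).trans (le_of_eq ?_)
    simp [fc]
  have hcont : Continuous (𝓕 fc) :=
    VectorFourier.fourierIntegral_continuous Real.continuous_fourierChar
      (innerSL ℝ).continuous₂ hfc
  -- The L² transform coincides with the Fourier integral on L¹ ∩ L²: both satisfy the same duality
  -- with test functions.
  have heq : (fun ξ => hat hf ξ) =ᵐ[volume] 𝓕 fc := by
    refine ae_eq_of_integral_contDiff_smul_eq (L2C.locallyIntegrable _)
      hcont.locallyIntegrable fun φ hφ hc => ?_
    have hc' : HasCompactSupport (fun x => (φ x : ℂ)) := hc.comp_left (g := Complex.ofReal) rfl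
    have hφ' : ContDiff ℝ ∞ (fun x => (φ x : ℂ)) := Complex.ofRealCLM.contDiff.comp hφ
    have h1 := integral_fourier_mul (toL2C hf) (hc'.toSchwartzMap hφ')
    have h2 : ∫ ξ, (𝓕 (hc'.toSchwartzMap hφ') : 𝓢(Space, ℂ)) ξ * fc ξ =
        ∫ x, (hc'.toSchwartzMap hφ') x * 𝓕 fc x := by
      simpa using! VectorFourier.integral_bilin_fourierIntegral_eq_flip (.mul ℂ ℂ)
        (L := innerₗ Space) Real.continuous_fourierChar continuous_inner
        (hc'.toSchwartzMap hφ').integrable hfc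
    have h3 : ∫ ξ, (𝓕 (hc'.toSchwartzMap hφ') : 𝓢(Space, ℂ)) ξ * fc ξ =
        ∫ ξ, (𝓕 (hc'.toSchwartzMap hφ') : 𝓢(Space, ℂ)) ξ * toL2C hf ξ := by
      refine integral_congr_ae ?_
      filter_upwards [coeFn_toL2C hf] with x hx
      rw [hx]
    have h4 := h1.symm.trans (h3.symm.trans h2)
    simpa using! h4
  filter_upwards [heq] with ξ hξ
  rw [hξ]
  exact hb ξ

/-- In polar coordinates the factor r² of three-dimensional volume cancels the singularity. -/
theorem integrableOn_ball_norm_sq_inv :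
    IntegrableOn (fun ξ : Space => (‖ξ‖ ^ 2)⁻¹) (Metric.ball 0 1) := by
  rw [integrableOn_fun_norm_addHaar volume (f := fun y : ℝ => (y ^ 2)⁻¹)]
  have : IntegrableOn (fun _ : ℝ => (1 : ℝ)) (Ioo 0 1) := by simp
  refine this.congr_fun (fun y hy => ?_) measurableSet_Ioo
  have : y ≠ 0 := hy.1.ne'
  simp [this]

theorem re_integral_ofReal_mul {a : Space → ℝ} (ha : MemLp a 2 volume) (F : L2C) :
    (∫ x, (a x : ℂ) * F x).re = ∫ x, a x * (F x).re := by
  have : Integrable fun x => (a x : ℂ) * F x := (ha.ofReal (K := ℂ)).integrable_mul (Lp.memLp F)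
  rw [← RCLike.re_eq_complex_re, ← integral_re this]
  simp

theorem integral_lineDeriv_mul (F : L2C) (u : 𝓢(Space, ℂ)) (j : Fin 3) :
    ∫ x, (∂_{basisVec j} u : 𝓢(Space, ℂ)) x * F x =
      -∫ ξ, (𝓕⁻ u : 𝓢(Space, ℂ)) ξ * (2 * Real.pi * Complex.I * ξ j * (𝓕 F : L2C) ξ) := by
  rw [← integral_lineDeriv_fourier_mul, FourierTransform.fourier_fourierInv_eq]

/-- Square integrable and integrable fields on `ℝ³` have a stray field. -/
theorem exists_isStrayField {M : Space → Space} (hM : MemLp M 2 volume) (hi : Integrable M) :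
    ∃ H, IsStrayField M H := by
  let v : Fin 3 → Space → ℂ := fun k => hat (MemLp.coord hM k)
  let s : Space → ℂ := fun ξ => ∑ k, (ξ k : ℂ) * v k ξ
  have hv : ∀ k, MemLp (v k) 2 volume := fun k => Lp.memLp _
  have hsm : AEStronglyMeasurable s volume := by
    refine Finset.aestronglyMeasurable_fun_sum _ fun k _ => ?_
    exact (Continuous.aestronglyMeasurable (by fun_prop)).mul (hv k).aestronglyMeasurable
  have hnm : AEStronglyMeasurable (fun ξ : Space => (((‖ξ‖ ^ 2)⁻¹ : ℝ) : ℂ)) volume := by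
    exact Measurable.aestronglyMeasurable (by fun_prop)
  have hs : ∀ ξ, ‖s ξ‖ ≤ ‖ξ‖ * ∑ k, ‖v k ξ‖ := fun ξ => by
    refine (norm_sum_le _ _).trans ?_
    rw [Finset.mul_sum]
    refine Finset.sum_le_sum fun k _ => ?_
    rw [norm_mul, Complex.norm_real]
    exact mul_le_mul_of_nonneg_right (PiLp.norm_apply_le ξ k) (norm_nonneg _)
  have hsum : MemLp (fun ξ => ∑ k, ‖v k ξ‖) 2 volume :=
    memLp_finsetSum _ fun k _ => (hv k).norm
  let B : ℝ := ∑ k : Fin 3, ∫ x, ‖M x k‖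
  have hB : ∀ᵐ ξ, ∑ k, ‖v k ξ‖ ≤ B := by
    have : ∀ᵐ ξ, ∀ k, ‖v k ξ‖ ≤ ∫ x, ‖M x k‖ := ae_all_iff.2 fun k =>
      norm_hat_le _ ((EuclideanSpace.proj k : Space →L[ℝ] ℝ).integrable_comp hi)
    filter_upwards [this] with ξ h
    exact Finset.sum_le_sum fun k _ => h k
  -- The Fourier transform of the potential.
  let p : Space → ℂ := fun ξ => (((‖ξ‖ ^ 2)⁻¹ : ℝ) : ℂ) * s ξ / (2 * Real.pi * Complex.I)
  have hpn : ∀ ξ, ‖p ξ‖ ≤ ‖ξ‖⁻¹ * ∑ k, ‖v k ξ‖ := fun ξ => by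
    have h2 : (1 : ℝ) ≤ 2 * Real.pi := by linarith [Real.pi_gt_three]
    simp only [p, norm_div, norm_mul, Complex.norm_real, Complex.norm_I, Complex.norm_ofNat,
      mul_one, Real.norm_of_nonneg Real.pi_pos.le]
    refine (div_le_self (by positivity) h2).trans ?_
    rw [Real.norm_of_nonneg (by positivity)]
    refine (mul_le_mul_of_nonneg_left (hs ξ) (by positivity)).trans (le_of_eq ?_)
    by_cases hξ : ‖ξ‖ = 0
    · simp [hξ]
    · field_simp
  have hpm : AEStronglyMeasurable p volume := by
    simp only [p, div_eq_mul_inv]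
    exact (hnm.mul hsm).mul_const _
  have hp : MemLp p 2 volume := by
    rw [memLp_two_iff_integrable_sq_norm hpm]
    -- In the unit ball |p|² is at most B²/|ξ|², which is integrable there. Outside, 1/|ξ| ≤ 1 and
    -- the L² bound on the transform of M suffices.
    have hb : Integrable ((Metric.ball (0 : Space) 1).indicator
        (fun ξ : Space => B ^ 2 * (‖ξ‖ ^ 2)⁻¹)) :=
      IntegrableOn.integrable_indicator (integrableOn_ball_norm_sq_inv.const_mul _)
        measurableSet_ball
    refine (hb.add hsum.integrable_sq).mono' (hpm.norm.pow 2) ?_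
    filter_upwards [hB] with ξ hξ
    have hn : 0 ≤ ∑ k, ‖v k ξ‖ := Finset.sum_nonneg fun k _ => norm_nonneg _
    have h1 : ‖p ξ‖ ^ 2 ≤ (‖ξ‖ ^ 2)⁻¹ * (∑ k, ‖v k ξ‖) ^ 2 := by
      refine (pow_le_pow_left₀ (norm_nonneg _) (hpn ξ) 2).trans (le_of_eq ?_)
      rw [mul_pow, inv_pow]
    rw [norm_pow, norm_norm]
    refine h1.trans ?_
    by_cases hξ1 : ξ ∈ Metric.ball (0 : Space) 1
    · rw [Pi.add_apply, indicator_of_mem hξ1]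
      have : (∑ k, ‖v k ξ‖) ^ 2 ≤ B ^ 2 := pow_le_pow_left₀ hn hξ 2
      have h2 : 0 ≤ (‖ξ‖ ^ 2)⁻¹ := by positivity
      nlinarith [mul_le_mul_of_nonneg_left this h2, sq_nonneg (∑ k, ‖v k ξ‖)]
    · rw [Pi.add_apply, indicator_of_notMem hξ1, zero_add]
      refine mul_le_of_le_one_left (sq_nonneg _) (inv_le_one_of_one_le₀ ?_)
      rw [mem_ball_zero_iff, not_lt] at hξ1
      exact one_le_pow₀ hξ1
  -- The Fourier transform of its gradient.
  let q : Fin 3 → Space → ℂ := fun j ξ => 2 * Real.pi * Complex.I * ξ j * p ξ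
  have hqe : ∀ j ξ, q j ξ = ξ j * ((((‖ξ‖ ^ 2)⁻¹ : ℝ) : ℂ) * s ξ) := fun j ξ => by
    have := Complex.two_pi_I_ne_zero
    simp only [q, p]
    field_simp
  have hqm : ∀ j, AEStronglyMeasurable (q j) volume := fun j =>
    (Continuous.aestronglyMeasurable (by fun_prop)).mul hpm
  have hq : ∀ j, MemLp (q j) 2 volume := fun j => by
    refine hsum.mono (hqm j) (.of_forall fun ξ => ?_)
    rw [hqe, Real.norm_of_nonneg (Finset.sum_nonneg fun k _ => norm_nonneg _)]
    rw [norm_mul, norm_mul, Complex.norm_real, Complex.norm_real,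
      Real.norm_of_nonneg (by positivity : (0 : ℝ) ≤ (‖ξ‖ ^ 2)⁻¹)]
    refine (mul_le_mul (PiLp.norm_apply_le ξ j)
      (mul_le_mul_of_nonneg_left (hs ξ) (by positivity)) (by positivity) (norm_nonneg _)).trans ?_
    by_cases hξ : ‖ξ‖ = 0
    · rw [hξ]; simp only [zero_mul]; exact Finset.sum_nonneg fun k _ => norm_nonneg _
    · apply le_of_eq; field_simp
  let P : L2C := 𝓕⁻ (hp.toLp p : L2C)
  let Q : Fin 3 → L2C := fun j => 𝓕⁻ ((hq j).toLp (q j) : L2C)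
  have hP : ∀ᵐ ξ, (𝓕 P : L2C) ξ = p ξ := by
    rw [show (𝓕 P : L2C) = hp.toLp p from FourierTransform.fourier_fourierInv_eq _]
    exact hp.coeFn_toLp
  have hQ : ∀ j, ∀ᵐ ξ, (𝓕 (Q j) : L2C) ξ = q j ξ := fun j => by
    rw [show (𝓕 (Q j) : L2C) = (hq j).toLp (q j) from FourierTransform.fourier_fourierInv_eq _]
    exact (hq j).coeFn_toLp
  have test : ∀ φ : Space → ℝ, IsTestFunction univ φ → ∃ u : 𝓢(Space, ℂ), (∀ x, u x = φ x) ∧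
      ∀ j x, (∂_{basisVec j} u : 𝓢(Space, ℂ)) x = fderiv ℝ φ x (basisVec j) := fun φ hφ => by
    have hc' : HasCompactSupport (fun x => (φ x : ℂ)) :=
      hφ.compact.comp_left (g := Complex.ofReal) rfl
    have hφ' : ContDiff ℝ ∞ (fun x => (φ x : ℂ)) := Complex.ofRealCLM.contDiff.comp hφ.smooth
    refine ⟨hc'.toSchwartzMap hφ', fun x => rfl, fun j x => ?_⟩
    have : HasFDerivAt (fun x => (φ x : ℂ)) (Complex.ofRealCLM.comp (fderiv ℝ φ x)) x :=
      Complex.ofRealCLM.hasFDerivAt.comp x (hφ.smooth.differentiable (by simp) x).hasFDerivAt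
    rw [SchwartzMap.lineDerivOp_apply_eq_fderiv]
    change fderiv ℝ (fun x => (φ x : ℂ)) x (basisVec j) = _
    rw [this.fderiv]
    rfl
  have hPre : MemLp (fun x => (P x).re) 2 volume := (Lp.memLp P).re
  let G : Space → Space := fun x => WithLp.toLp 2 fun j => (Q j x).re
  have hG : MemLp G 2 volume := by
    have hGm : AEStronglyMeasurable G volume := by
      have h1 : AEMeasurable (fun x j => (Q j x).re) volume :=
        aemeasurable_pi_lambda _ fun j => (Lp.memLp (Q j)).re.aestronglyMeasurable.aemeasurable
      exact ((PiLp.continuous_toLp 2 _).measurable.comp_aemeasurable h1).aestronglyMeasurable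
    rw [memLp_two_iff_integrable_sq_norm hGm]
    simp only [norm_sq_eq_sum]
    exact integrable_finsetSum _ fun j _ => (Lp.memLp (Q j)).re.integrable_sq
  have hgrad : ∀ φ : Space → ℝ, IsTestFunction univ φ → ∀ j,
      ∫ x, fderiv ℝ φ x (basisVec j) * (P x).re = -∫ x, φ x * (Q j x).re := fun φ hφ j => by
    obtain ⟨u, hu, hu'⟩ := test φ hφ
    rw [← re_integral_ofReal_mul (hφ.memLp_fderiv _), ← re_integral_ofReal_mul hφ.memLp]
    simp_rw [← hu, ← hu']
    rw [integral_lineDeriv_mul, Complex.neg_re]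
    congr 2
    nth_rw 2 [← FourierTransform.fourier_fourierInv_eq (F := 𝓢(Space, ℂ)) u]
    rw [integral_fourier_mul]
    refine integral_congr_ae ?_
    filter_upwards [hP, hQ j] with ξ h1 h2
    rw [h1, h2]
  have hdiv : ∀ φ : Space → ℝ, IsTestFunction univ φ →
      ∑ j, ∫ x, fderiv ℝ φ x (basisVec j) * G x j =
        ∑ j, ∫ x, fderiv ℝ φ x (basisVec j) * M x j := fun φ hφ => by
    obtain ⟨u, hu, hu'⟩ := test φ hφ
    have h1 : ∀ F : Fin 3 → L2C, ∑ j, ∫ x, (∂_{basisVec j} u : 𝓢(Space, ℂ)) x * F j x =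
        -∫ ξ, (𝓕⁻ u : 𝓢(Space, ℂ)) ξ *
          (2 * Real.pi * Complex.I * ∑ j, ξ j * (𝓕 (F j) : L2C) ξ) := fun F => by
      simp only [integral_lineDeriv_mul, Finset.mul_sum, ← mul_assoc]
      simp only [mul_assoc]
      rw [integral_finsetSum, Finset.sum_neg_distrib]
      intro j _
      have := integrable_schwartz_mul_coord_mul (𝓕 (F j)) (𝓕⁻ u) j
      simpa only [mul_assoc] using this
    have h2 : ∑ j, ∫ x, (∂_{basisVec j} u : 𝓢(Space, ℂ)) x * Q j x =
        ∑ j, ∫ x, (∂_{basisVec j} u : 𝓢(Space, ℂ)) x * toL2C (MemLp.coord hM j) x := by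
      rw [h1, h1]
      congr 1
      refine integral_congr_ae ?_
      filter_upwards [ae_all_iff.2 hQ] with ξ h2
      congr 2
      -- The multiplier ξ⊗ξ/|ξ|² that defines `q` preserves the component along ξ, so `Q` and M have
      -- the same divergence.
      change _ = s ξ
      simp only [h2, hqe]
      by_cases hξ : ‖ξ‖ = 0
      · have h0 : s ξ = 0 := norm_le_zero_iff.1 ((hs ξ).trans (by simp [hξ]))
        simp [h0]
      · have : ∑ j, (ξ j : ℂ) * (ξ j * ((((‖ξ‖ ^ 2)⁻¹ : ℝ) : ℂ) * s ξ)) =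
            ((∑ j, ξ j ^ 2 : ℝ) : ℂ) * ((((‖ξ‖ ^ 2)⁻¹ : ℝ) : ℂ) * s ξ) := by
          push_cast
          rw [Finset.sum_mul]
          exact Finset.sum_congr rfl fun j _ => by ring
        rw [this, ← norm_sq_eq_sum, ← mul_assoc, ← Complex.ofReal_mul,
          mul_inv_cancel₀ (pow_ne_zero 2 hξ), Complex.ofReal_one, one_mul]
    have h3 := congrArg Complex.re h2
    rw [Complex.re_sum, Complex.re_sum] at h3
    simp_rw [hu', re_integral_ofReal_mul (hφ.memLp_fderiv _)] at h3
    refine h3.trans (Finset.sum_congr rfl fun j _ => integral_congr_ae ?_)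
    filter_upwards [coeFn_toL2C (MemLp.coord hM j)] with x hx
    rw [hx, Complex.ofReal_re]
  refine ⟨fun x => -G x, fun x => (P x).re, G, ⟨hPre, ⟨?_, ?_, ?_⟩, hG, ?_⟩, .rfl⟩
  · exact (hPre.locallyIntegrable (by norm_num)).locallyIntegrableOn _
  · exact (hG.locallyIntegrable (by norm_num)).locallyIntegrableOn _
  · intro φ hφ j
    simp only [Measure.restrict_univ, gradient_coord]
    simpa only [mul_comm] using hgrad φ hφ j
  · intro φ hφ
    rw [integral_inner_gradient hG hφ, integral_inner_gradient hM hφ]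
    exact hdiv φ hφ

/-! ### Pointwise estimates at a fixed frequency -/

theorem norm_sq_sum_mul_le (ξ : Space) (v : Fin 3 → ℂ) :
    ‖∑ k, (ξ k : ℂ) * v k‖ ^ 2 ≤ ‖ξ‖ ^ 2 * ∑ k, ‖v k‖ ^ 2 := by
  have h1 : ‖∑ k, (ξ k : ℂ) * v k‖ ≤ ∑ k, |ξ k| * ‖v k‖ := by
    refine (norm_sum_le _ _).trans (Finset.sum_le_sum fun k _ => ?_)
    rw [norm_mul, Complex.norm_real, Real.norm_eq_abs]
  refine (pow_le_pow_left₀ (norm_nonneg _) h1 2).trans ?_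
  refine (Finset.sum_mul_sq_le_sq_mul_sq _ _ _).trans (le_of_eq ?_)
  simp only [sq_abs, norm_sq_eq_sum]

theorem symbolEnergy_le (ξ : Space) (v : Fin 3 → ℂ) : symbolEnergy ξ v ≤ ∑ k, ‖v k‖ ^ 2 :=
  div_le_of_le_mul₀ (sq_nonneg _) (Finset.sum_nonneg fun _ _ => sq_nonneg _) <| by
    rw [mul_comm]; exact norm_sq_sum_mul_le ξ v

theorem symbolEnergy_nonneg (ξ : Space) (v : Fin 3 → ℂ) : 0 ≤ symbolEnergy ξ v := by
  unfold symbolEnergy; positivity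

theorem two_mul_le_weighted {l x y : ℝ} (hl : 0 < l) :
    2 * (x * y) ≤ (l ^ 2)⁻¹ * x ^ 2 + l ^ 2 * y ^ 2 := by
  have h : (l⁻¹ * x - l * y) ^ 2 = (l ^ 2)⁻¹ * x ^ 2 + l ^ 2 * y ^ 2 - 2 * (x * y) := by
    field_simp
    ring
  nlinarith [sq_nonneg (l⁻¹ * x - l * y)]

theorem abs_mul_coord_div_le (ξ : Space) (i j : Fin 3) : |ξ i * ξ j / ‖ξ‖ ^ 2| ≤ 1 := by
  rw [abs_div, abs_mul, abs_of_nonneg (sq_nonneg ‖ξ‖), pow_two]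
  exact div_le_one_of_le₀ (mul_le_mul (PiLp.norm_apply_le ξ i) (PiLp.norm_apply_le ξ j)
    (abs_nonneg _) (norm_nonneg _)) (by positivity)

theorem norm_ofReal_mul_le {c : ℝ} (hc : |c| ≤ 1) (z : ℂ) : ‖(c : ℂ) * z‖ ≤ ‖z‖ := by
  rw [norm_mul, Complex.norm_real, Real.norm_eq_abs]
  exact mul_le_of_le_one_left (norm_nonneg _) hc

/-- If `d = ∂₃ f`, then `d` interacts with `n` through the projection `ξ ⊗ ξ / |ξ|²` as through
`e₃ ⊗ e₃`, up to horizontal derivatives of `n`. -/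
theorem norm_projection_sub_vertical_le {ξ : Space} (hξ : ξ ≠ 0) {d n f : Fin 3 → ℂ}
    {a : Fin 3 → Fin 3 → ℂ} (hd : ∀ j, d j = 2 * Real.pi * Complex.I * ξ 2 * f j)
    (ha : ∀ i j, a i j = 2 * Real.pi * Complex.I * ξ i * n j) :
    ‖starRingEnd ℂ (∑ k, (ξ k : ℂ) * d k) * (∑ k, (ξ k : ℂ) * n k) / ((‖ξ‖ ^ 2 : ℝ) : ℂ) -
        starRingEnd ℂ (d 2) * n 2‖ ≤
      (∑ j, ‖f j‖) * ∑ j, (‖a 0 j‖ + ‖a 1 j‖) := by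
  have hw : (‖ξ‖ ^ 2 : ℝ) ≠ 0 := by positivity
  have hw' : ((‖ξ‖ ^ 2 : ℝ) : ℂ) ≠ 0 := by exact_mod_cast hw
  have hsum : ((‖ξ‖ ^ 2 : ℝ) : ℂ) = (ξ 0 : ℂ) ^ 2 + (ξ 1 : ℂ) ^ 2 + (ξ 2 : ℂ) ^ 2 := by
    rw [norm_sq_eq_sum, Fin.sum_univ_three]; push_cast; ring
  let c : Fin 3 → ℝ := fun k => ξ 2 * ξ k / ‖ξ‖ ^ 2
  have hc : ∀ k, |c k| ≤ 1 := fun k => abs_mul_coord_div_le ξ 2 k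
  have hcC : ∀ k, (c k : ℂ) = ξ 2 * ξ k / ((‖ξ‖ ^ 2 : ℝ) : ℂ) := fun k => by
    simp only [c]; push_cast; ring
  -- `V j` is the factor multiplying the conjugate of `f j` once d = 2πi ξ₃ f is inserted. For
  -- horizontal j the projection itself supplies ξ_j. In the vertical component, removing e₃⊗e₃
  -- leaves ξ₃(ξ₁n₁ + ξ₂n₂) − (ξ₁² + ξ₂²)n₃, so each term again carries a horizontal frequency, that
  -- is, an entry of `a 0` or `a 1`. The remaining coefficients ξ₃ξ_k/|ξ|² are at most 1.
  let V : Fin 3 → ℂ := ![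
    -(c 0 * a 0 0 + c 1 * a 0 1 + c 2 * a 0 2),
    -(c 0 * a 1 0 + c 1 * a 1 1 + c 2 * a 1 2),
    -(c 2 * a 0 0 + c 2 * a 1 1 - c 0 * a 0 2 - c 1 * a 1 2)]
  have hT : starRingEnd ℂ (∑ k, (ξ k : ℂ) * d k) * (∑ k, (ξ k : ℂ) * n k) / ((‖ξ‖ ^ 2 : ℝ) : ℂ) -
        starRingEnd ℂ (d 2) * n 2 = ∑ j, starRingEnd ℂ (f j) * V j := by
    simp only [Fin.sum_univ_three, V, Matrix.cons_val_zero, Matrix.cons_val_one, Matrix.cons_val,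
      hcC, ha, hd, map_add, map_mul, Complex.conj_ofReal, Complex.conj_I, map_ofNat]
    field_simp
    rw [hsum]
    ring
  have hV : ∀ j, ‖V j‖ ≤ ∑ j, (‖a 0 j‖ + ‖a 1 j‖) := by
    have hb : ∀ k i j, ‖(c k : ℂ) * a i j‖ ≤ ‖a i j‖ := fun k i j => norm_ofReal_mul_le (hc k) _
    have hn : ∀ i j, 0 ≤ ‖a i j‖ := fun i j => norm_nonneg _
    intro j
    rw [Fin.sum_univ_three]
    fin_cases j
    · simp only [V, Fin.zero_eta, Matrix.cons_val_zero, norm_neg]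
      refine (norm_add₃_le).trans ?_
      linarith [hb 0 0 0, hb 1 0 1, hb 2 0 2, hn 1 0, hn 1 1, hn 1 2]
    · simp only [V, Fin.mk_one, Matrix.cons_val_one, Matrix.cons_val_zero, norm_neg]
      refine (norm_add₃_le).trans ?_
      linarith [hb 0 1 0, hb 1 1 1, hb 2 1 2, hn 0 0, hn 0 1, hn 0 2]
    · simp only [V, Fin.reduceFinMk, Matrix.cons_val, norm_neg]
      have h1 := norm_sub_le ((c 2 : ℂ) * a 0 0 + c 2 * a 1 1 - c 0 * a 0 2) (c 1 * a 1 2)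
      have h2 := norm_sub_le ((c 2 : ℂ) * a 0 0 + c 2 * a 1 1) (c 0 * a 0 2)
      have h3 := norm_add_le ((c 2 : ℂ) * a 0 0) (c 2 * a 1 1)
      linarith [hb 2 0 0, hb 2 1 1, hb 0 0 2, hb 1 1 2, hn 0 1, hn 1 0]
  rw [hT, Finset.sum_mul]
  refine (norm_sum_le _ _).trans (Finset.sum_le_sum fun j _ => ?_)
  rw [norm_mul, RCLike.norm_conj]
  exact mul_le_mul_of_nonneg_left (hV j) (norm_nonneg _)

/-- Expanding the square leaves the terms D–D, D–R and D–N. The first two are bounded by the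
contraction property, the last by `norm_projection_sub_vertical_le`. The free length `l` balances
the primitive f against the horizontal derivatives of n, and will be the thickness. -/
theorem abs_symbolEnergy_sub_le (ξ : Space) {d n r f : Fin 3 → ℂ} {a : Fin 3 → Fin 3 → ℂ} {l : ℝ}
    (hl : 0 < l) (hd : ∀ j, d j = 2 * Real.pi * Complex.I * ξ 2 * f j)
    (ha : ∀ i j, a i j = 2 * Real.pi * Complex.I * ξ i * n j) :
    |symbolEnergy ξ (fun k => n k + r k + d k) - symbolEnergy ξ (fun k => n k + r k) -
        2 * (starRingEnd ℂ (d 2) * n 2).re| ≤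
      2 * ∑ j, ‖d j‖ ^ 2 + ∑ j, ‖r j‖ ^ 2 + (l ^ 2)⁻¹ * ∑ j, ‖f j‖ ^ 2 +
        18 * l ^ 2 * ∑ j, (‖a 0 j‖ ^ 2 + ‖a 1 j‖ ^ 2) := by
  by_cases hξ : ξ = 0
  · subst hξ
    simp only [symbolEnergy, norm_zero, hd]
    simp only [ne_eq, OfNat.ofNat_ne_zero, not_false_eq_true, zero_pow, div_zero, PiLp.zero_apply,
      Complex.ofReal_zero, mul_zero, zero_mul, map_zero, Complex.zero_re, sub_zero, abs_zero]
    have h1 : 0 ≤ ∑ j, ‖r j‖ ^ 2 := Finset.sum_nonneg fun _ _ => sq_nonneg _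
    have h2 : 0 ≤ ∑ j, ‖f j‖ ^ 2 := Finset.sum_nonneg fun _ _ => sq_nonneg _
    have h3 : 0 ≤ ∑ j, (‖a 0 j‖ ^ 2 + ‖a 1 j‖ ^ 2) := Finset.sum_nonneg fun _ _ => by positivity
    simp only [norm_zero, ne_eq, OfNat.ofNat_ne_zero, not_false_eq_true, zero_pow,
      Finset.sum_const_zero]
    positivity
  have hw : (0 : ℝ) < ‖ξ‖ ^ 2 := by positivity
  have hT := norm_projection_sub_vertical_le hξ hd ha
  set D := ∑ k, (ξ k : ℂ) * d k with hD
  set N := ∑ k, (ξ k : ℂ) * n k with hN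
  set R := ∑ k, (ξ k : ℂ) * r k with hR
  have hDb := norm_sq_sum_mul_le ξ d
  have hRb := norm_sq_sum_mul_le ξ r
  rw [← hD] at hDb
  rw [← hR] at hRb
  have e1 : ∑ k, (ξ k : ℂ) * (n k + r k) = N + R := by
    simp only [mul_add, Finset.sum_add_distrib, hN, hR]
  have e2 : ∑ k, (ξ k : ℂ) * (n k + r k + d k) = N + R + D := by
    simp only [mul_add, Finset.sum_add_distrib, hN, hR, hD]
  have key : symbolEnergy ξ (fun k => n k + r k + d k) - symbolEnergy ξ (fun k => n k + r k) -
      2 * (starRingEnd ℂ (d 2) * n 2).re =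
      ‖D‖ ^ 2 / ‖ξ‖ ^ 2 + 2 * (starRingEnd ℂ D * R).re / ‖ξ‖ ^ 2 +
        2 * (starRingEnd ℂ D * N / ((‖ξ‖ ^ 2 : ℝ) : ℂ) - starRingEnd ℂ (d 2) * n 2).re := by
    rw [symbolEnergy, symbolEnergy, e1, e2, Complex.sub_re, Complex.div_ofReal_re]
    have : ‖N + R + D‖ ^ 2 = ‖N + R‖ ^ 2 + ‖D‖ ^ 2 + 2 * (starRingEnd ℂ D * R).re +
        2 * (starRingEnd ℂ D * N).re := by
      simp only [← Complex.normSq_eq_norm_sq, Complex.normSq_apply, Complex.add_re, Complex.add_im,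
        Complex.mul_re, Complex.conj_re, Complex.conj_im]
      ring
    rw [this]
    field_simp
    ring
  have b1 : ‖D‖ ^ 2 / ‖ξ‖ ^ 2 ≤ ∑ j, ‖d j‖ ^ 2 := by rw [div_le_iff₀ hw]; linarith
  have b1' : 0 ≤ ‖D‖ ^ 2 / ‖ξ‖ ^ 2 := by positivity
  have b2 : |2 * (starRingEnd ℂ D * R).re / ‖ξ‖ ^ 2| ≤ ∑ j, ‖d j‖ ^ 2 + ∑ j, ‖r j‖ ^ 2 := by
    rw [abs_div, abs_mul, abs_two, abs_of_pos hw, div_le_iff₀ hw]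
    have h1 : |(starRingEnd ℂ D * R).re| ≤ ‖D‖ * ‖R‖ := by
      refine (Complex.abs_re_le_norm _).trans (le_of_eq ?_)
      rw [norm_mul, RCLike.norm_conj]
    nlinarith [sq_nonneg (‖D‖ - ‖R‖)]
  have b3 : |2 * (starRingEnd ℂ D * N / ((‖ξ‖ ^ 2 : ℝ) : ℂ) - starRingEnd ℂ (d 2) * n 2).re| ≤
      (l ^ 2)⁻¹ * ∑ j, ‖f j‖ ^ 2 + 18 * l ^ 2 * ∑ j, (‖a 0 j‖ ^ 2 + ‖a 1 j‖ ^ 2) := by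
    rw [abs_mul, abs_two]
    refine (mul_le_mul_of_nonneg_left ((Complex.abs_re_le_norm _).trans hT) zero_le_two).trans ?_
    have hA : (∑ j, (‖a 0 j‖ + ‖a 1 j‖)) ^ 2 ≤ 6 * ∑ j, (‖a 0 j‖ ^ 2 + ‖a 1 j‖ ^ 2) := by
      refine (sq_sum_le_card_mul_sum_sq).trans ?_
      rw [Finset.card_univ, Fintype.card_fin, Finset.mul_sum, Finset.mul_sum]
      refine Finset.sum_le_sum fun j _ => ?_
      push_cast
      nlinarith [sq_nonneg (‖a 0 j‖ - ‖a 1 j‖)]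
    -- Young's inequality for each of the three `f j` gives 3l² times the squared sum of the `a`'s.
    -- That square is at most 6 times the sum of squares, hence the factor 18.
    rw [Finset.sum_mul, Finset.mul_sum]
    refine (Finset.sum_le_sum fun j _ => two_mul_le_weighted hl).trans ?_
    rw [Finset.sum_add_distrib, ← Finset.mul_sum, Finset.sum_const, Finset.card_univ,
      Fintype.card_fin, nsmul_eq_mul]
    push_cast
    nlinarith [mul_le_mul_of_nonneg_left hA (by positivity : 0 ≤ 3 * l ^ 2)]
  rw [key]
  refine (abs_add_three _ _ _).trans ?_
  rw [abs_of_nonneg b1']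
  linarith

/-! ### From frequencies to energies -/

theorem integrable_symbolEnergy {v : Fin 3 → Space → ℂ} (hv : ∀ k, MemLp (v k) 2 volume) :
    Integrable fun ξ => symbolEnergy ξ fun k => v k ξ := by
  have hsm : AEStronglyMeasurable (fun ξ : Space => ∑ k, (ξ k : ℂ) * v k ξ) volume :=
    Finset.aestronglyMeasurable_fun_sum _ fun k _ =>
      (Continuous.aestronglyMeasurable (by fun_prop)).mul (hv k).aestronglyMeasurable
  have hm : AEStronglyMeasurable (fun ξ => symbolEnergy ξ fun k => v k ξ) volume := by
    simp only [symbolEnergy, div_eq_mul_inv]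
    exact (hsm.norm.pow 2).mul (Measurable.aestronglyMeasurable (by fun_prop))
  refine (integrable_finsetSum Finset.univ fun k _ => (hv k).norm.integrable_sq).mono' hm
    (.of_forall fun ξ => ?_)
  rw [Real.norm_of_nonneg (symbolEnergy_nonneg _ _)]
  exact symbolEnergy_le _ _

/-- The energies of the stray fields of `M` and `N + R` are close if `M - (N + R) = ∂₃ F` and `N`
has horizontal derivatives `A`. -/
theorem abs_integral_strayField_sub_le {M Mb H Hb : Space → Space} {N R D F : Fin 3 → Space → ℝ}
    {A : Fin 3 → Fin 3 → Space → ℝ} {l : ℝ} (hl : 0 < l)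
    (hM : MemLp M 2 volume) (hMb : MemLp Mb 2 volume)
    (hN : ∀ j, MemLp (N j) 2 volume) (hR : ∀ j, MemLp (R j) 2 volume)
    (hD : ∀ j, MemLp (D j) 2 volume) (hF : ∀ j, MemLp (F j) 2 volume)
    (hA : ∀ i j, i ≠ 2 → MemLp (A i j) 2 volume)
    (hMb_eq : ∀ j, (fun x => Mb x j) =ᵐ[volume] fun x => N j x + R j x)
    (hM_eq : ∀ j, (fun x => M x j) =ᵐ[volume] fun x => Mb x j + D j x)
    (hDF : ∀ j, ∀ φ : Space → ℝ, IsTestFunction univ φ →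
      ∫ x, fderiv ℝ φ x (basisVec 2) * F j x = -∫ x, φ x * D j x)
    (hNA : ∀ i j, i ≠ 2 → ∀ φ : Space → ℝ, IsTestFunction univ φ →
      ∫ x, fderiv ℝ φ x (basisVec i) * N j x = -∫ x, φ x * A i j x)
    (horth : ∫ x, D 2 x * N 2 x = 0)
    (hH : IsStrayField M H) (hHb : IsStrayField Mb Hb) :
    |(∫ x, ‖H x‖ ^ 2) - ∫ x, ‖Hb x‖ ^ 2| ≤
      2 * (∑ j, ∫ x, D j x ^ 2) + (∑ j, ∫ x, R j x ^ 2) + (l ^ 2)⁻¹ * (∑ j, ∫ x, F j x ^ 2) +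
        18 * l ^ 2 * ∑ j, ((∫ x, A 0 j x ^ 2) + ∫ x, A 1 j x ^ 2) := by
  have h0 : (0 : Fin 3) ≠ 2 := by decide
  have h1 : (1 : Fin 3) ≠ 2 := by decide
  rw [hH.integral_norm_sq hM, hHb.integral_norm_sq hMb]
  have e1 : ∀ᵐ ξ, ∀ j, hat (MemLp.coord hMb j) ξ = hat (hN j) ξ + hat (hR j) ξ :=
    ae_all_iff.2 fun j => hat_add _ _ _ (hMb_eq j)
  have e2 : ∀ᵐ ξ, ∀ j, hat (MemLp.coord hM j) ξ =
      hat (MemLp.coord hMb j) ξ + hat (hD j) ξ :=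
    ae_all_iff.2 fun j => hat_add _ _ _ (hM_eq j)
  have e3 : ∀ᵐ ξ, ∀ j, hat (hD j) ξ = 2 * Real.pi * Complex.I * ξ 2 * hat (hF j) ξ :=
    ae_all_iff.2 fun j => hat_weakDeriv _ _ 2 (hDF j)
  have e4 : ∀ᵐ ξ, ∀ j, hat (hA 0 j h0) ξ = 2 * Real.pi * Complex.I * ξ 0 * hat (hN j) ξ :=
    ae_all_iff.2 fun j => hat_weakDeriv _ _ 0 (hNA 0 j h0)
  have e5 : ∀ᵐ ξ, ∀ j, hat (hA 1 j h1) ξ = 2 * Real.pi * Complex.I * ξ 1 * hat (hN j) ξ :=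
    ae_all_iff.2 fun j => hat_weakDeriv _ _ 1 (hNA 1 j h1)
  have hsq : ∀ {f : Space → ℝ} (hf : MemLp f 2 volume), Integrable fun ξ => ‖hat hf ξ‖ ^ 2 :=
    fun hf => (Lp.memLp _).norm.integrable_sq
  -- The e₃⊗e₃ contribution is not small pointwise in ξ. It disappears only after integration, where
  -- Plancherel returns it to the orthogonality of D₃ and N₃.
  have hcross : ∫ ξ, 2 * (starRingEnd ℂ (hat (hD 2) ξ) * hat (hN 2) ξ).re = 0 := by
    rw [integral_const_mul, ← integral_mul_eq_hat, horth, mul_zero]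
  have hcross_int : Integrable fun ξ =>
      2 * (starRingEnd ℂ (hat (hD 2) ξ) * hat (hN 2) ξ).re := by
    have h1 : Integrable fun ξ => inner ℂ (hat (hD 2) ξ) (hat (hN 2) ξ) := L2.integrable_inner _ _
    simp only [RCLike.inner_apply'] at h1
    exact h1.re.const_mul 2
  have i1 : Integrable fun ξ => symbolEnergy ξ fun k => hat (MemLp.coord hM k) ξ :=
    integrable_symbolEnergy fun k => Lp.memLp _
  have i2 : Integrable fun ξ => symbolEnergy ξ fun k => hat (MemLp.coord hMb k) ξ :=
    integrable_symbolEnergy fun k => Lp.memLp _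
  have iAj : ∀ j, Integrable fun ξ => ‖hat (hA 0 j h0) ξ‖ ^ 2 + ‖hat (hA 1 j h1) ξ‖ ^ 2 :=
    fun j => (hsq (hA 0 j h0)).add (hsq (hA 1 j h1))
  have iD : Integrable fun ξ => 2 * ∑ j, ‖hat (hD j) ξ‖ ^ 2 :=
    (integrable_finsetSum _ fun j _ => hsq (hD j)).const_mul _
  have iR : Integrable fun ξ => ∑ j, ‖hat (hR j) ξ‖ ^ 2 :=
    integrable_finsetSum _ fun j _ => hsq (hR j)
  have iF : Integrable fun ξ => (l ^ 2)⁻¹ * ∑ j, ‖hat (hF j) ξ‖ ^ 2 :=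
    (integrable_finsetSum _ fun j _ => hsq (hF j)).const_mul _
  have iA : Integrable fun ξ =>
      18 * l ^ 2 * ∑ j, (‖hat (hA 0 j h0) ξ‖ ^ 2 + ‖hat (hA 1 j h1) ξ‖ ^ 2) :=
    (integrable_finsetSum _ fun j _ => iAj j).const_mul _
  have iDR : Integrable fun ξ => 2 * ∑ j, ‖hat (hD j) ξ‖ ^ 2 + ∑ j, ‖hat (hR j) ξ‖ ^ 2 := iD.add iR
  have iDRF : Integrable fun ξ => 2 * ∑ j, ‖hat (hD j) ξ‖ ^ 2 + ∑ j, ‖hat (hR j) ξ‖ ^ 2 +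
      (l ^ 2)⁻¹ * ∑ j, ‖hat (hF j) ξ‖ ^ 2 := iDR.add iF
  have hb : Integrable fun ξ => 2 * ∑ j, ‖hat (hD j) ξ‖ ^ 2 + ∑ j, ‖hat (hR j) ξ‖ ^ 2 +
      (l ^ 2)⁻¹ * ∑ j, ‖hat (hF j) ξ‖ ^ 2 +
        18 * l ^ 2 * ∑ j, (‖hat (hA 0 j h0) ξ‖ ^ 2 + ‖hat (hA 1 j h1) ξ‖ ^ 2) := iDRF.add iA
  have hsub : Integrable fun ξ => symbolEnergy ξ (fun k => hat (MemLp.coord hM k) ξ) -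
      symbolEnergy ξ (fun k => hat (MemLp.coord hMb k) ξ) := i1.sub i2
  have hstep : (∫ ξ, symbolEnergy ξ fun k => hat (MemLp.coord hM k) ξ) -
      (∫ ξ, symbolEnergy ξ fun k => hat (MemLp.coord hMb k) ξ) =
      ∫ ξ, (symbolEnergy ξ (fun k => hat (MemLp.coord hM k) ξ) -
        symbolEnergy ξ (fun k => hat (MemLp.coord hMb k) ξ) -
        2 * (starRingEnd ℂ (hat (hD 2) ξ) * hat (hN 2) ξ).re) := by
    rw [integral_sub hsub hcross_int, integral_sub i1 i2, hcross, sub_zero]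
  rw [hstep, ← Real.norm_eq_abs]
  refine (norm_integral_le_of_norm_le hb ?_).trans (le_of_eq ?_)
  · filter_upwards [e1, e2, e3, e4, e5] with ξ e1 e2 e3 e4 e5
    rw [Real.norm_eq_abs]
    simp only [e2, e1]
    let a : Fin 3 → Fin 3 → ℂ := fun i j => 2 * Real.pi * Complex.I * ξ i * hat (hN j) ξ
    have := abs_symbolEnergy_sub_le ξ (r := fun j => hat (hR j) ξ) (a := a)
      (n := fun j => hat (hN j) ξ) hl e3 (fun _ _ => rfl)
    simpa only [a, ← e4, ← e5] using this
  · rw [integral_add iDRF iA, integral_add iDR iF, integral_add iD iR, integral_const_mul,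
      integral_const_mul, integral_const_mul, integral_finsetSum _ fun j _ => hsq (hD j),
      integral_finsetSum _ fun j _ => hsq (hR j), integral_finsetSum _ fun j _ => hsq (hF j),
      integral_finsetSum _ fun j _ => iAj j]
    simp_rw [integral_add (hsq (hA 0 _ h0)) (hsq (hA 1 _ h1)), ← integral_sq_eq_hat]

/-! ### Means and primitives in the thickness variable -/

/-- Lebesgue measure on the thickness interval `[0, t]`. -/
abbrev thick (t : ℝ) : Measure ℝ := volume.restrict (Icc 0 t)

theorem thick_real_univ {t : ℝ} (ht : 0 < t) : (thick t).real univ = t := by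
  simp [thick, ht.le]

theorem integral_thick_const {t : ℝ} (ht : 0 < t) (c : ℝ) : ∫ _, c ∂thick t = t * c := by
  rw [integral_const, thick_real_univ ht, smul_eq_mul]

section OneDimensional

variable {t : ℝ} (ht : 0 < t)

include ht

/-- The variance identity. Its nonnegative left side gives Cauchy–Schwarz and the contraction
property of averaging; discarding the square of the mean gives the one for subtracting it. -/
theorem integral_sub_mean_sq {f : ℝ → ℝ} (hf : MemLp f 2 (thick t)) :
    ∫ z, (f z - t⁻¹ * ∫ s, f s ∂thick t) ^ 2 ∂thick t =
      ∫ z, f z ^ 2 ∂thick t - t * (t⁻¹ * ∫ s, f s ∂thick t) ^ 2 := by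
  set I := ∫ s, f s ∂thick t
  have h1 : ∀ z, (f z - t⁻¹ * I) ^ 2 = f z ^ 2 - 2 * (t⁻¹ * I) * f z + (t⁻¹ * I) ^ 2 :=
    fun z => by ring
  have hfi : Integrable f (thick t) := hf.integrable (by norm_num)
  have i1 : Integrable (fun z => 2 * (t⁻¹ * I) * f z) (thick t) := hfi.const_mul _
  have i2 : Integrable (fun z => f z ^ 2 - 2 * (t⁻¹ * I) * f z) (thick t) := hf.integrable_sq.sub i1
  simp_rw [h1]
  rw [integral_add i2 (integrable_const _), integral_sub hf.integrable_sq i1, integral_const_mul,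
    integral_thick_const ht]
  change ∫ z, f z ^ 2 ∂thick t - 2 * (t⁻¹ * I) * I + t * (t⁻¹ * I) ^ 2 = _
  field_simp
  ring

theorem sq_integral_thick_le {f : ℝ → ℝ} (hf : MemLp f 2 (thick t)) :
    (∫ z, f z ∂thick t) ^ 2 ≤ t * ∫ z, f z ^ 2 ∂thick t := by
  have h1 : 0 ≤ ∫ z, (f z - t⁻¹ * ∫ s, f s ∂thick t) ^ 2 ∂thick t :=
    integral_nonneg fun _ => sq_nonneg _
  rw [integral_sub_mean_sq ht hf] at h1
  have h2 : t * (t⁻¹ * ∫ s, f s ∂thick t) ^ 2 = t⁻¹ * (∫ s, f s ∂thick t) ^ 2 := by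
    field_simp
  rw [h2, sub_nonneg, inv_mul_le_iff₀ ht] at h1
  exact h1

omit ht in
-- Integration by parts against the primitive of a merely integrable function. Fubini on the
-- triangle s ≤ z replaces any differentiability of that primitive. The boundary term at 0 is absent
-- because the primitive starts there.
theorem integral_primitive_mul_deriv {k b b' : ℝ → ℝ} (hk : Integrable k (thick t))
    (hb : ∀ z, HasDerivAt b (b' z) z) (hb' : Continuous b') :
    ∫ z, (∫ s, (if s ≤ z then k s else 0) ∂thick t) * b' z ∂thick t =
      b t * (∫ s, k s ∂thick t) - ∫ s, b s * k s ∂thick t := by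
  have hbc : Continuous b := continuous_iff_continuousAt.2 fun z => (hb z).continuousAt
  have hb'i : Integrable b' (thick t) := hb'.integrableOn_Icc
  have hmul : Integrable (fun p : ℝ × ℝ => b' p.1 * k p.2) ((thick t).prod (thick t)) :=
    hb'i.mul_prod hk
  have hset : MeasurableSet {p : ℝ × ℝ | p.2 ≤ p.1} :=
    measurableSet_le measurable_snd measurable_fst
  have hint : Integrable (Function.uncurry fun z s => (if s ≤ z then k s else 0) * b' z)
      ((thick t).prod (thick t)) := by
    refine (hmul.indicator hset).congr (.of_forall fun p => ?_)
    by_cases hp : p.2 ≤ p.1 <;> simp [Function.uncurry, indicator, hp, mul_comm]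
  simp_rw [← integral_mul_const]
  rw [integral_integral_swap hint]
  have hkb : Integrable (fun s => b s * k s) (thick t) := by
    have := IntegrableOn.continuousOn_mul (K := Icc 0 t) hbc.continuousOn hk isCompact_Icc
    exact this
  rw [← integral_const_mul, ← integral_sub (hk.const_mul _) hkb]
  refine setIntegral_congr_fun measurableSet_Icc fun s hs => ?_
  have h1 : ∀ z, (if s ≤ z then k s else 0) * b' z = k s * (Ici s).indicator b' z := fun z => by
    by_cases hz : s ≤ z <;> simp [indicator, hz]
  simp_rw [h1]
  rw [integral_const_mul, integral_indicator measurableSet_Ici, Measure.restrict_restrict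
    measurableSet_Ici]
  have h2 : Ici s ∩ Icc 0 t = Icc s t := by
    ext z; simp only [mem_inter_iff, mem_Ici, mem_Icc]
    exact ⟨fun h => ⟨h.1, h.2.2⟩, fun h => ⟨h.1, hs.1.trans h.1, h.2⟩⟩
  rw [h2, integral_Icc_eq_integral_Ioc, ← intervalIntegral.integral_of_le hs.2,
    intervalIntegral.integral_eq_sub_of_hasDerivAt (fun z _ => hb z)
      (hb'.intervalIntegrable _ _)]
  ring

end OneDimensional

section Product

variable {X : Type*} [MeasurableSpace X] {μ : Measure X} [IsFiniteMeasure μ] {t : ℝ}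

/-- The average of `f` over the thickness variable. -/
def vmean (t : ℝ) (f : X × ℝ → ℝ) (x : X) : ℝ := t⁻¹ * ∫ z, f (x, z) ∂thick t

/-- The primitive of `f` in the thickness variable that vanishes at the bottom. -/
def vprim (t : ℝ) (f : X × ℝ → ℝ) (p : X × ℝ) : ℝ :=
  ∫ s, (if s ≤ p.2 then f (p.1, s) else 0) ∂thick t

theorem ae_memLp_slice {f : X × ℝ → ℝ} (hf : MemLp f 2 (μ.prod (thick t))) :
    ∀ᵐ x ∂μ, MemLp (fun z => f (x, z)) 2 (thick t) := by
  filter_upwards [hf.aestronglyMeasurable.prodMk_left, hf.integrable_sq.prod_right_ae] with x h1 h2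
  exact (memLp_two_iff_integrable_sq h1).2 h2

variable (ht : 0 < t)

include ht

theorem memLp_vmean {f : X × ℝ → ℝ} (hf : MemLp f 2 (μ.prod (thick t))) :
    MemLp (vmean t f) 2 μ := by
  have hm : AEStronglyMeasurable (vmean t f) μ :=
    hf.aestronglyMeasurable.integral_prod_right'.const_mul _
  rw [memLp_two_iff_integrable_sq hm]
  refine (hf.integrable_sq.integral_prod_left.const_mul t⁻¹).mono' (hm.pow 2) ?_
  filter_upwards [ae_memLp_slice hf] with x hx
  have := sq_integral_thick_le ht hx
  rw [Real.norm_of_nonneg (sq_nonneg _), vmean, mul_pow]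
  calc (t⁻¹) ^ 2 * (∫ z, f (x, z) ∂thick t) ^ 2
      ≤ (t⁻¹) ^ 2 * (t * ∫ z, f (x, z) ^ 2 ∂thick t) := by gcongr
    _ = t⁻¹ * ∫ z, f (x, z) ^ 2 ∂thick t := by field_simp

theorem integral_vmean_sq_le {f : X × ℝ → ℝ} (hf : MemLp f 2 (μ.prod (thick t))) :
    ∫ p, vmean t f p.1 ^ 2 ∂μ.prod (thick t) ≤ ∫ p, f p ^ 2 ∂μ.prod (thick t) := by
  have hv := memLp_vmean ht hf
  rw [integral_prod _ (hv.integrable_sq.comp_fst (thick t)), integral_prod _ hf.integrable_sq]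
  simp only [integral_thick_const ht]
  refine integral_mono_ae (hv.integrable_sq.const_mul _) hf.integrable_sq.integral_prod_left ?_
  filter_upwards [ae_memLp_slice hf] with x hx
  have h1 : 0 ≤ ∫ z, (f (x, z) - t⁻¹ * ∫ s, f (x, s) ∂thick t) ^ 2 ∂thick t :=
    integral_nonneg fun _ => sq_nonneg _
  rw [integral_sub_mean_sq ht hx] at h1
  exact sub_nonneg.1 h1

theorem memLp_sub_vmean {f : X × ℝ → ℝ} (hf : MemLp f 2 (μ.prod (thick t))) :
    MemLp (fun p => f p - vmean t f p.1) 2 (μ.prod (thick t)) :=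
  hf.sub ((memLp_vmean ht hf).comp_fst (thick t))

theorem integral_sub_vmean_sq_le {f : X × ℝ → ℝ} (hf : MemLp f 2 (μ.prod (thick t))) :
    ∫ p, (f p - vmean t f p.1) ^ 2 ∂μ.prod (thick t) ≤ ∫ p, f p ^ 2 ∂μ.prod (thick t) := by
  have hv := memLp_sub_vmean ht hf
  rw [integral_prod _ hv.integrable_sq, integral_prod _ hf.integrable_sq]
  refine integral_mono_ae hv.integrable_sq.integral_prod_left
    hf.integrable_sq.integral_prod_left ?_
  filter_upwards [ae_memLp_slice hf] with x hx
  refine (integral_sub_mean_sq ht hx).trans_le (sub_le_self _ (by positivity))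

theorem ae_integral_sub_vmean {f : X × ℝ → ℝ} (hf : MemLp f 2 (μ.prod (thick t))) :
    ∀ᵐ x ∂μ, ∫ z, (f (x, z) - vmean t f x) ∂thick t = 0 := by
  filter_upwards [ae_memLp_slice hf] with x hx
  rw [integral_sub (hx.integrable (by norm_num)) (integrable_const _), integral_thick_const ht,
    vmean]
  field_simp
  simp

/-- On each vertical line the second factor is constant and the first has zero integral. This is the
orthogonality that removes the vertical cross term. -/
theorem integral_sub_vmean_mul {f : X × ℝ → ℝ} (hf : MemLp f 2 (μ.prod (thick t))) {h : X → ℝ}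
    (hh : MemLp h 2 μ) : ∫ p, (f p - vmean t f p.1) * h p.1 ∂μ.prod (thick t) = 0 := by
  have hi := integrable_mul_of_memLp (memLp_sub_vmean ht hf) (hh.comp_fst (thick t))
  rw [integral_prod _ hi]
  refine integral_eq_zero_of_ae ?_
  filter_upwards [ae_integral_sub_vmean ht hf] with x hx
  simp only [integral_mul_const, hx, zero_mul, Pi.zero_apply]

omit ht in
-- With the upper limit written as an indicator, the primitive is a partial integral of a measurable
-- function of three variables over a fixed measure.
theorem aestronglyMeasurable_vprim {f : X × ℝ → ℝ}
    (hf : AEStronglyMeasurable f (μ.prod (thick t))) :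
    AEStronglyMeasurable (vprim t f) (μ.prod (thick t)) := by
  have hq : Measure.QuasiMeasurePreserving (fun q : (X × ℝ) × ℝ => (q.1.1, q.2))
      ((μ.prod (thick t)).prod (thick t)) (μ.prod (thick t)) :=
    QuasiMeasurePreserving.prodMap Measure.quasiMeasurePreserving_fst
      (Measure.QuasiMeasurePreserving.id _)
  have h1 := (hf.comp_quasiMeasurePreserving hq).indicator
    (measurableSet_le (measurable_snd (α := X × ℝ) (β := ℝ))
      (measurable_snd.comp measurable_fst))
  refine AEStronglyMeasurable.congr h1.integral_prod_right' (.of_forall fun p => ?_)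
  refine integral_congr_ae (.of_forall fun s => ?_)
  by_cases hs : s ≤ p.2 <;> simp [indicator, hs]

/-- Cauchy–Schwarz on the part of the vertical line below z. The bound is uniform in z, so a further
integration over the thickness costs just another factor t. -/
theorem ae_vprim_sq_le {f : X × ℝ → ℝ} (hf : MemLp f 2 (μ.prod (thick t))) :
    ∀ᵐ x ∂μ, ∀ z, vprim t f (x, z) ^ 2 ≤ t * ∫ s, f (x, s) ^ 2 ∂thick t := by
  filter_upwards [ae_memLp_slice hf] with x hx z
  have hi : MemLp ((Iic z).indicator fun s => f (x, s)) 2 (thick t) :=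
    hx.indicator measurableSet_Iic
  have h1 : vprim t f (x, z) = ∫ s, (Iic z).indicator (fun s => f (x, s)) s ∂thick t :=
    integral_congr_ae (.of_forall fun s => by by_cases hs : s ≤ z <;> simp [indicator, hs])
  rw [h1]
  refine (sq_integral_thick_le ht hi).trans ?_
  gcongr t * ?_
  refine integral_mono hi.integrable_sq hx.integrable_sq fun s => ?_
  by_cases hs : s ≤ z <;> simp [indicator, hs, sq_nonneg]

theorem memLp_vprim {f : X × ℝ → ℝ} (hf : MemLp f 2 (μ.prod (thick t))) :
    MemLp (vprim t f) 2 (μ.prod (thick t)) := by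
  have hm := aestronglyMeasurable_vprim hf.aestronglyMeasurable
  rw [memLp_two_iff_integrable_sq hm]
  refine ((hf.integrable_sq.integral_prod_left.const_mul t).comp_fst (thick t)).mono' (hm.pow 2) ?_
  filter_upwards [Measure.quasiMeasurePreserving_fst.ae (ae_vprim_sq_le ht hf)] with p hp
  rw [Real.norm_of_nonneg (sq_nonneg _)]
  exact hp p.2

theorem integral_vprim_sq_le {f : X × ℝ → ℝ} (hf : MemLp f 2 (μ.prod (thick t))) :
    ∫ p, vprim t f p ^ 2 ∂μ.prod (thick t) ≤ t ^ 2 * ∫ p, f p ^ 2 ∂μ.prod (thick t) := by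
  have hi := hf.integrable_sq.integral_prod_left.const_mul t
  have h1 : ∫ p, vprim t f p ^ 2 ∂μ.prod (thick t) ≤
      ∫ p, t * ∫ s, f (p.1, s) ^ 2 ∂thick t ∂μ.prod (thick t) := by
    refine integral_mono_ae (memLp_vprim ht hf).integrable_sq (hi.comp_fst (thick t)) ?_
    filter_upwards [Measure.quasiMeasurePreserving_fst.ae (ae_vprim_sq_le ht hf)] with p hp
    exact hp p.2
  refine h1.trans (le_of_eq ?_)
  rw [integral_prod _ (hi.comp_fst (thick t)), integral_prod _ hf.integrable_sq]
  simp only [integral_thick_const ht, integral_const_mul]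
  ring

end Product

/-! ### Weak vertical derivatives in the film: du Bois-Reymond and Poincaré -/

/-- The measure of the film `Ω × [0, t]`. -/
abbrev film (Ω : Set Plane) (t : ℝ) : Measure (Plane × ℝ) := (volume.restrict Ω).prod (thick t)

theorem film_eq_restrict (Ω : Set Plane) (t : ℝ) :
    film Ω t = (volume : Measure (Plane × ℝ)).restrict (Ω ×ˢ Icc 0 t) :=
  Measure.prod_restrict _ _

theorem film_eq_restrict_Ioo (Ω : Set Plane) (t : ℝ) :
    film Ω t = (volume : Measure (Plane × ℝ)).restrict (Ω ×ˢ Ioo 0 t) := by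
  rw [film, thick, ← restrict_Ioo_eq_restrict_Icc]
  exact Measure.prod_restrict _ _

/-- Test functions compactly supported in `U ⊆ ℝ² × ℝ`. -/
structure IsFilmTest (U : Set (Plane × ℝ)) (φ : Plane × ℝ → ℝ) : Prop where
  smooth : ContDiff ℝ ∞ φ
  compact : HasCompactSupport φ
  support : tsupport φ ⊆ U

/-- `g` is the weak derivative of `f` in the direction `v` in the film `Ω × (0, t)`. -/
def HasFilmDeriv (Ω : Set Plane) (t : ℝ) (v : Plane × ℝ) (f g : Plane × ℝ → ℝ) : Prop :=
  ∀ φ : Plane × ℝ → ℝ, IsFilmTest (Ω ×ˢ Ioo 0 t) φ →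
    ∫ p, fderiv ℝ φ p v * f p ∂film Ω t = -∫ p, φ p * g p ∂film Ω t

/-- Primitive of a function of `(x, z)` in the variable `z`. -/
def zPrim (φ : Plane × ℝ → ℝ) (p : Plane × ℝ) : ℝ := ∫ s in (0 : ℝ)..p.2, φ (p.1, s)

theorem hasDerivAt_zPrim {φ : Plane × ℝ → ℝ} (hφ : Continuous φ) (x : Plane) (z : ℝ) :
    HasDerivAt (fun z => zPrim φ (x, z)) (φ (x, z)) z := by
  have hc : Continuous fun s => φ (x, s) := by fun_prop
  exact intervalIntegral.integral_hasDerivAt_right (hc.intervalIntegrable _ _)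
    hc.aestronglyMeasurable.stronglyMeasurableAtFilter hc.continuousAt

open scoped Convolution in
-- Since φ vanishes for heights below 0, its primitive is the convolution in z with the Heaviside
-- function, with x as a parameter. Joint smoothness then comes from the theory of convolutions.
theorem contDiff_zPrim {φ : Plane × ℝ → ℝ} {Ω : Set Plane} {t : ℝ}
    (hφ : IsFilmTest (Ω ×ˢ Ioo 0 t) φ) : ContDiff ℝ ∞ (zPrim φ) := by
  let h : ℝ → ℝ := (Ici 0).indicator fun _ => 1
  have hh : LocallyIntegrable h := (locallyIntegrable_const 1).indicator measurableSet_Ici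
  let k : Set ℝ := Prod.snd '' tsupport φ
  have hk : IsCompact k := hφ.compact.isCompact.image continuous_snd
  have h0 : ∀ x s, s ∉ k → φ (x, s) = 0 := fun x s hs =>
    image_eq_zero_of_notMem_tsupport fun hx => hs ⟨(x, s), hx, rfl⟩
  have h1 := contDiffOn_convolution_right_with_param (μ := volume) (n := (⊤ : ℕ∞))
    (f := h) (ContinuousLinearMap.mul ℝ ℝ)
    (g := fun x s => φ (x, s)) (s := univ) isOpen_univ hk (fun x s _ hs => h0 x s hs) hh
    (by exact hφ.smooth.contDiffOn)
  rw [univ_prod_univ, contDiffOn_univ] at h1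
  convert h1 using 1
  ext ⟨x, z⟩
  have hc : Continuous fun s => φ (x, s) := hφ.smooth.continuous.comp (by fun_prop)
  have hcs : HasCompactSupport fun s => φ (x, s) :=
    HasCompactSupport.intro hk fun s hs => h0 x s hs
  have hi : Integrable fun s => φ (x, s) := hc.integrable_of_hasCompactSupport hcs
  have hneg : ∫ s in Iic 0, φ (x, s) = 0 := by
    refine setIntegral_eq_zero_of_forall_eq_zero fun s hs => h0 x s ?_
    rintro ⟨p, hp, rfl⟩
    exact absurd (hφ.support hp).2.1 (not_lt.2 hs)
  have h2 : zPrim φ (x, z) = ∫ s in Iic z, φ (x, s) := by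
    rw [zPrim, ← intervalIntegral.integral_Iic_sub_Iic hi.integrableOn hi.integrableOn, hneg,
      sub_zero]
  rw [h2, convolution_def, ← integral_sub_left_eq_self _ volume z,
    ← integral_indicator measurableSet_Iic]
  refine integral_congr_ae (.of_forall fun s => ?_)
  by_cases hs : s ≤ z <;> simp [h, indicator, hs]

/-- A smooth step from `0` near the bottom to `1` near the top of `[0, t]`. -/
def step (t z : ℝ) : ℝ := Real.smoothTransition (3 * z / t - 1)

theorem contDiff_step (t : ℝ) : ContDiff ℝ ∞ (step t) :=
  Real.smoothTransition.contDiff.comp (by fun_prop)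

theorem step_eq_zero {t z : ℝ} (ht : 0 < t) (hz : z ≤ t / 3) : step t z = 0 :=
  Real.smoothTransition.zero_of_nonpos (by rw [sub_nonpos, div_le_one ht]; linarith)

theorem step_eq_one {t z : ℝ} (ht : 0 < t) (hz : 2 * t / 3 ≤ z) : step t z = 1 :=
  Real.smoothTransition.one_of_one_le (by rw [le_sub_iff_add_le, le_div_iff₀ ht]; linarith)

/-- A compactly supported vertical primitive of `φ`, up to a fixed profile. -/
def compactPrim (t : ℝ) (φ : Plane × ℝ → ℝ) (p : Plane × ℝ) : ℝ :=
  zPrim φ p - zPrim φ (p.1, t) * step t p.2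

theorem hasDerivAt_compactPrim {φ : Plane × ℝ → ℝ} (hφ : Continuous φ) (t : ℝ) (x : Plane) (z : ℝ) :
    HasDerivAt (fun z => compactPrim t φ (x, z)) (φ (x, z) - zPrim φ (x, t) * deriv (step t) z) z :=
  (hasDerivAt_zPrim hφ x z).sub
    (((contDiff_step t).differentiable (by simp) z).hasDerivAt.const_mul (zPrim φ (x, t)))

/-- The plain primitive keeps the value of the full integral above the support of φ. Subtracting
that value times the step makes the function vanish near the top as well as near the bottom. -/
theorem isFilmTest_compactPrim {φ : Plane × ℝ → ℝ} {Ω : Set Plane} {t : ℝ} (ht : 0 < t)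
    (hφ : IsFilmTest (Ω ×ˢ Ioo 0 t) φ) : IsFilmTest (Ω ×ˢ Ioo 0 t) (compactPrim t φ) := by
  have hJ := contDiff_zPrim hφ
  have hsm : ContDiff ℝ ∞ (compactPrim t φ) :=
    hJ.sub ((hJ.comp (contDiff_fst.prodMk contDiff_const)).mul ((contDiff_step t).comp contDiff_snd))
  have hK := hφ.compact.isCompact
  -- The lowest and highest heights in the support; if the support is empty, t/2 serves for both.
  obtain ⟨a, b, ha, hb, hab⟩ : ∃ a b, 0 < a ∧ b < t ∧ ∀ p ∈ tsupport φ, a ≤ p.2 ∧ p.2 ≤ b := by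
    by_cases hne : (tsupport φ).Nonempty
    · obtain ⟨p, hp, hpm⟩ := hK.exists_isMinOn hne continuous_snd.continuousOn
      obtain ⟨q, hq, hqm⟩ := hK.exists_isMaxOn hne continuous_snd.continuousOn
      exact ⟨p.2, q.2, (hφ.support hp).2.1, (hφ.support hq).2.2, fun r hr => ⟨hpm hr, hqm hr⟩⟩
    · rw [not_nonempty_iff_eq_empty] at hne
      exact ⟨t / 2, t / 2, by linarith, by linarith, by simp [hne]⟩
  let a' := min a (t / 3)
  let b' := max b (2 * t / 3)
  have ha' : 0 < a' := lt_min ha (by linarith)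
  have hb' : b' < t := max_lt hb (by linarith)
  let S : Set (Plane × ℝ) := (Prod.fst '' tsupport φ) ×ˢ Icc a' b'
  have hS : IsCompact S := (hK.image continuous_fst).prod isCompact_Icc
  have hSU : S ⊆ Ω ×ˢ Ioo 0 t := by
    rintro ⟨x, z⟩ ⟨⟨p, hp, rfl⟩, hz⟩
    exact ⟨(hφ.support hp).1, ha'.trans_le hz.1, hz.2.trans_lt hb'⟩
  have hzero : ∀ p ∉ S, compactPrim t φ p = 0 := by
    rintro ⟨x, z⟩ hp
    have hnot : ∀ s, (x, s) ∉ tsupport φ → φ (x, s) = 0 := fun s hs =>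
      image_eq_zero_of_notMem_tsupport hs
    by_cases hx : x ∈ Prod.fst '' tsupport φ
    · have hz : z ∉ Icc a' b' := fun hz => hp ⟨hx, hz⟩
      rw [mem_Icc, not_and_or, not_le, not_le] at hz
      rcases hz with hz | hz
      · have h1 : zPrim φ (x, z) = 0 := by
          refine intervalIntegral.integral_zero_ae (.of_forall fun s hs => hnot s fun hs' => ?_)
          have h2 := (hab _ hs').1
          have h3 : s ≤ max 0 z := hs.2
          have h4 : max 0 z < a := max_lt ha (hz.trans_le (min_le_left _ _))
          exact absurd (h3.trans_lt h4) (not_lt.2 h2)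
        rw [compactPrim, h1, step_eq_zero ht (hz.le.trans (min_le_right _ _))]
        simp
      · have hc : Continuous fun s => φ (x, s) := hφ.smooth.continuous.comp (by fun_prop)
        have h1 : zPrim φ (x, t) - zPrim φ (x, z) = 0 := by
          rw [zPrim, zPrim, intervalIntegral.integral_interval_sub_left
            (hc.intervalIntegrable _ _) (hc.intervalIntegrable _ _)]
          refine intervalIntegral.integral_zero_ae (.of_forall fun s hs => hnot s fun hs' => ?_)
          have h2 := (hab _ hs').2
          have h3 : min z t < s := hs.1
          have h4 : b < min z t := lt_min ((le_max_left _ _).trans_lt hz) hb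
          exact absurd (h4.trans h3) (not_lt.2 h2)
        rw [compactPrim, step_eq_one ht ((le_max_right _ _).trans hz.le)]
        linarith
    · have h1 : ∀ s, φ (x, s) = 0 := fun s => hnot s fun hs => hx ⟨_, hs, rfl⟩
      simp [compactPrim, zPrim, h1]
  have hsub : tsupport (compactPrim t φ) ⊆ S :=
    closure_minimal (fun p hp => by_contra fun h => hp (hzero p h)) hS.isClosed
  exact ⟨hsm, HasCompactSupport.intro hS hzero, hsub.trans hSU⟩

theorem fderiv_apply_vertical {ψ : Plane × ℝ → ℝ} {x : Plane} {z d : ℝ}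
    (hψ : DifferentiableAt ℝ ψ (x, z)) (hd : HasDerivAt (fun z => ψ (x, z)) d z) :
    fderiv ℝ ψ (x, z) (0, 1) = d := by
  have h1 : HasDerivAt (fun z : ℝ => (x, z)) (0, 1) z :=
    (hasDerivAt_const z x).prodMk (hasDerivAt_id z)
  exact (hψ.hasFDerivAt.comp_hasDerivAt z h1).unique hd

theorem IsFilmTest.memLp {U : Set (Plane × ℝ)} {φ : Plane × ℝ → ℝ} (h : IsFilmTest U φ)
    (ν : Measure (Plane × ℝ)) [IsFiniteMeasure ν] : MemLp φ 2 ν :=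
  h.smooth.continuous.memLp_of_hasCompactSupport h.compact

theorem IsFilmTest.memLp_fderiv {U : Set (Plane × ℝ)} {φ : Plane × ℝ → ℝ} (h : IsFilmTest U φ)
    (ν : Measure (Plane × ℝ)) [IsFiniteMeasure ν] (v : Plane × ℝ) :
    MemLp (fun p => fderiv ℝ φ p v) 2 ν :=
  ((h.smooth.continuous_fderiv (by simp)).clm_apply continuous_const).memLp_of_hasCompactSupport
    (h.compact.fderiv_apply ℝ v)

section DuBoisReymond

variable {Ω : Set Plane} {t : ℝ} {f g : Plane × ℝ → ℝ} [IsFiniteMeasure (volume.restrict Ω)]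

/-- The primitive of the vertical derivative differs from the function by a function of `x`. -/
theorem HasFilmDeriv.exists_eq_vprim_add (hΩ : IsOpen Ω) (ht : 0 < t)
    (hf : MemLp f 2 (film Ω t)) (hg : MemLp g 2 (film Ω t)) (h : HasFilmDeriv Ω t (0, 1) f g) :
    ∃ w : Plane → ℝ, ∀ᵐ p ∂film Ω t, f p = vprim t g p + w p.1 := by
  let W : Plane × ℝ → ℝ := fun p => f p - vprim t g p
  have hP := memLp_vprim ht hg
  have hW : MemLp W 2 (film Ω t) := hf.sub hP
  have hstep' : Continuous (deriv (step t)) := (contDiff_step t).continuous_deriv (by simp)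
  -- B has unit integral over the thickness, so `w` below is a weighted vertical mean of W. If W
  -- depends on x alone, as is to be shown, it must coincide with `w`.
  let B : Plane × ℝ → ℝ := fun p => deriv (step t) p.2
  have hBm : MemLp (deriv (step t)) 2 (thick t) := by
    refine (memLp_two_iff_integrable_sq hstep'.aestronglyMeasurable).2 ?_
    exact (hstep'.pow 2).integrableOn_Icc
  have hB : MemLp B 2 (film Ω t) := hBm.comp_snd _
  have hWB : Integrable (fun p => W p * B p) (film Ω t) := integrable_mul_of_memLp hW hB
  let w : Plane → ℝ := fun x => ∫ z, W (x, z) * B (x, z) ∂thick t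
  have hw : Integrable w (volume.restrict Ω) := hWB.integral_prod_left
  have key : ∀ φ : Plane × ℝ → ℝ, IsFilmTest (Ω ×ˢ Ioo 0 t) φ →
      ∫ p, φ p * (W p - w p.1) ∂film Ω t = 0 := by
    intro φ hφ
    have hψ := isFilmTest_compactPrim ht hφ
    have hφc := hφ.smooth.continuous
    obtain ⟨C, hC⟩ := hφ.compact.exists_bound_of_continuous hφc
    have hd : ∀ p, fderiv ℝ (compactPrim t φ) p (0, 1) = φ p - zPrim φ (p.1, t) * B p :=
      fun p => fderiv_apply_vertical (hψ.smooth.differentiable (by simp) _)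
        (hasDerivAt_compactPrim hφc t p.1 p.2)
    have hdm : MemLp (fun p => φ p - zPrim φ (p.1, t) * B p) 2 (film Ω t) := by
      simpa only [hd] using hψ.memLp_fderiv (film Ω t) (0, 1)
    have hJm : MemLp (fun p : Plane × ℝ => zPrim φ (p.1, t) * B p) 2 (film Ω t) := by
      refine ((hφ.memLp (film Ω t)).sub hdm).ae_eq (.of_forall fun p => ?_)
      simp
    have e1 : ∫ p, (φ p - zPrim φ (p.1, t) * B p) * f p ∂film Ω t =
        -∫ p, compactPrim t φ p * g p ∂film Ω t := by
      simpa only [hd] using h _ hψ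
    -- The primitive of g satisfies the same weak equation as f, so W has zero weak vertical
    -- derivative. The boundary term at height t drops out because `compactPrim` vanishes there.
    have e2 : ∫ p, (φ p - zPrim φ (p.1, t) * B p) * vprim t g p ∂film Ω t =
        -∫ p, compactPrim t φ p * g p ∂film Ω t := by
      rw [integral_prod _ (integrable_mul_of_memLp hdm hP),
        integral_prod _ (integrable_mul_of_memLp (hψ.memLp _) hg), ← integral_neg]
      refine integral_congr_ae ?_
      filter_upwards [ae_memLp_slice hg] with x hx
      have h1 := integral_primitive_mul_deriv (hx.integrable (by norm_num))
        (fun z => hasDerivAt_compactPrim hφc t x z)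
        (by
          have : Continuous fun z => φ (x, z) := by fun_prop
          exact this.sub (continuous_const.mul hstep'))
      have h2 : compactPrim t φ (x, t) = 0 := by
        rw [compactPrim, step_eq_one ht (by linarith)]; simp
      rw [h2, zero_mul, zero_sub] at h1
      rw [← h1]
      refine integral_congr_ae (.of_forall fun z => ?_)
      simp only [B, vprim, mul_comm]
    have e3 : ∫ p, (φ p - zPrim φ (p.1, t) * B p) * W p ∂film Ω t = 0 := by
      simp only [W, mul_sub]
      rw [integral_sub (integrable_mul_of_memLp hdm hf) (integrable_mul_of_memLp hdm hP), e1, e2,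
        sub_self]
    have iφW := integrable_mul_of_memLp (hφ.memLp (film Ω t)) hW
    have iJW := integrable_mul_of_memLp hJm hW
    have iφw : Integrable (fun p : Plane × ℝ => φ p * w p.1) (film Ω t) :=
      (hw.comp_fst (thick t)).bdd_mul hφc.aestronglyMeasurable (.of_forall hC)
    -- Fubini on each vertical line: both sides are the integral of φ times the integral of W·B.
    have e4 : ∫ p, zPrim φ (p.1, t) * B p * W p ∂film Ω t = ∫ p, φ p * w p.1 ∂film Ω t := by
      rw [integral_prod _ iJW, integral_prod _ iφw]
      refine integral_congr_ae (.of_forall fun x => ?_)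
      simp only
      rw [integral_mul_const]
      have : zPrim φ (x, t) = ∫ s, φ (x, s) ∂thick t := by
        rw [zPrim, intervalIntegral.integral_of_le ht.le, ← integral_Icc_eq_integral_Ioc]
      rw [this]
      simp only [w]
      rw [← integral_const_mul]
      refine integral_congr_ae (.of_forall fun z => ?_)
      simp only
      ring
    simp only [mul_sub]
    rw [integral_sub iφW iφw, ← e4, ← integral_sub iφW iJW, ← e3]
    simp only [sub_mul]
  have hWw : Integrable (fun p : Plane × ℝ => W p - w p.1) (film Ω t) :=
    (hW.integrable (by norm_num)).sub (hw.comp_fst (thick t))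
  have hU : IsOpen (Ω ×ˢ Ioo (0 : ℝ) t) := hΩ.prod isOpen_Ioo
  have hae : ∀ᵐ p ∂(volume : Measure (Plane × ℝ)), p ∈ Ω ×ˢ Ioo (0 : ℝ) t → W p - w p.1 = 0 := by
    refine hU.ae_eq_zero_of_integral_contDiff_smul_eq_zero ?_ fun φ h1 h2 h3 => ?_
    · rw [film_eq_restrict_Ioo] at hWw
      exact IntegrableOn.locallyIntegrableOn hWw
    · have := key φ ⟨h1, h2, h3⟩
      rw [film_eq_restrict_Ioo, setIntegral_eq_integral_of_forall_compl_eq_zero] at this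
      · exact this
      · intro p hp
        rw [image_eq_zero_of_notMem_tsupport fun h => hp (h3 h), zero_mul]
  refine ⟨w, ?_⟩
  rw [film_eq_restrict_Ioo, ae_restrict_iff' hU.measurableSet]
  filter_upwards [hae] with p hp hpU
  have := hp hpU
  simp only [W] at this
  linarith

/-- The function of x left undetermined by `exists_eq_vprim_add` is its own vertical mean, and so
cancels. -/
theorem HasFilmDeriv.sub_vmean_eq (hΩ : IsOpen Ω) (ht : 0 < t)
    (hf : MemLp f 2 (film Ω t)) (hg : MemLp g 2 (film Ω t)) (h : HasFilmDeriv Ω t (0, 1) f g) :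
    ∀ᵐ p ∂film Ω t, f p - vmean t f p.1 = vprim t g p - vmean t (vprim t g) p.1 := by
  obtain ⟨w, hw⟩ := h.exists_eq_vprim_add hΩ ht hf hg
  have h1 : ∀ᵐ x ∂volume.restrict Ω, vmean t f x = vmean t (vprim t g) x + w x := by
    filter_upwards [Measure.ae_ae_of_ae_prod hw, ae_memLp_slice (memLp_vprim ht hg)] with x hx hP
    rw [vmean, integral_congr_ae hx, integral_add (hP.integrable (by norm_num))
      (integrable_const _), integral_thick_const ht, vmean]
    field_simp
  filter_upwards [hw, Measure.quasiMeasurePreserving_fst.ae h1] with p h2 h3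
  rw [h2, h3]
  ring

/-- Poincaré inequality in the thickness direction. -/
theorem HasFilmDeriv.integral_sub_vmean_sq_le (hΩ : IsOpen Ω) (ht : 0 < t)
    (hf : MemLp f 2 (film Ω t)) (hg : MemLp g 2 (film Ω t)) (h : HasFilmDeriv Ω t (0, 1) f g) :
    ∫ p, (f p - vmean t f p.1) ^ 2 ∂film Ω t ≤ t ^ 2 * ∫ p, g p ^ 2 ∂film Ω t := by
  refine le_trans (le_of_eq ?_) ((_root_.integral_sub_vmean_sq_le ht (memLp_vprim ht hg)).trans
    (integral_vprim_sq_le ht hg))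
  refine integral_congr_ae ?_
  filter_upwards [h.sub_vmean_eq hΩ ht hf hg] with p hp
  rw [hp]

end DuBoisReymond

/-! ### Cutoffs in the plane and in the thickness -/

open scoped Convolution in
/-- A smooth cutoff supported in `Ω`, equal to `1` at distance at least `t` from the boundary, with
gradient of order `1 / t`. -/
theorem exists_cutoff {Ω : Set Plane} (hΩ : IsOpen Ω) (hb : Bornology.IsBounded Ω) {t : ℝ}
    (ht : 0 < t) :
    ∃ η : Plane → ℝ, ContDiff ℝ ∞ η ∧ HasCompactSupport η ∧ tsupport η ⊆ Ω ∧
      (∀ x, 0 ≤ η x ∧ η x ≤ 1) ∧ (∀ x, ‖fderiv ℝ η x‖ ≤ 4 / t) ∧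
      ∀ x ∈ Ω, x ∉ Metric.thickening t (frontier Ω) → η x = 1 ∧ fderiv ℝ η x = 0 := by
  have huniv : Ω ≠ univ := by
    rintro rfl
    exact NormedSpace.unbounded_univ ℝ Plane hb
  have hne : Ωᶜ.Nonempty := nonempty_compl.2 huniv
  let δ : Plane → ℝ := fun x => Metric.infDist x Ωᶜ
  have hδL : ∀ x y, δ x ≤ δ y + dist x y := fun x y => Metric.infDist_le_infDist_add_dist
  -- A ramp in the distance to the complement, 0 up to t/2 and 1 from 3t/4 on. Mollifying at radius
  -- t/4 keeps the Lipschitz constant 4/t and leaves the values 0 up to t/4 and 1 from t on.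
  let g : Plane → ℝ := fun x => max 0 (min 1 (4 / t * δ x - 2))
  have hg0 : ∀ x, 0 ≤ g x := fun x => le_max_left _ _
  have hg1 : ∀ x, g x ≤ 1 := fun x => max_le zero_le_one (min_le_left _ _)
  have hgL : ∀ x y, |g x - g y| ≤ 4 / t * dist x y := fun x y => by
    have h1 : |g x - g y| ≤ |(4 / t * δ x - 2) - (4 / t * δ y - 2)| := by
      simp only [g, max_comm (0 : ℝ), min_comm (1 : ℝ)]
      refine (abs_max_sub_max_le_abs _ _ _).trans ?_
      refine (abs_min_sub_min_le_max _ _ _ _).trans ?_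
      rw [sub_self, abs_zero, max_eq_left (abs_nonneg _)]
    refine h1.trans ?_
    rw [sub_sub_sub_cancel_right, ← mul_sub, abs_mul, abs_of_pos (by positivity : 0 < 4 / t)]
    gcongr
    rw [abs_sub_le_iff]
    constructor
    · linarith [hδL x y]
    · linarith [hδL y x, dist_comm x y]
  have hgc : Continuous g := by
    have : Continuous δ := Metric.continuous_infDist_pt _
    fun_prop
  let ρ : ContDiffBump (0 : Plane) := ⟨t / 8, t / 4, by positivity, by linarith⟩
  let k : Plane → ℝ := ρ.normed volume
  have hk0 : ∀ y, 0 ≤ k y := fun y => ρ.nonneg_normed y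
  have hk1 : ∫ y, k y = 1 := ρ.integral_normed
  have hki : Integrable k := ρ.integrable_normed
  let η : Plane → ℝ := k ⋆[ContinuousLinearMap.lsmul ℝ ℝ, volume] g
  have hη : ∀ x, η x = ∫ y, k y * g (x - y) := fun x => rfl
  have hint : ∀ x, Integrable fun y => k y * g (x - y) := fun x =>
    hki.mul_bdd (c := 1) (by fun_prop) (.of_forall fun y => by
      rw [Real.norm_of_nonneg (hg0 _)]; exact hg1 _)
  have hsm : ContDiff ℝ ∞ η :=
    ρ.hasCompactSupport_normed.contDiff_convolution_left _ ρ.contDiff_normed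
      hgc.locallyIntegrable
  have hηb : ∀ x, 0 ≤ η x ∧ η x ≤ 1 := fun x => by
    refine ⟨integral_nonneg fun y => mul_nonneg (hk0 y) (hg0 _), ?_⟩
    rw [hη, ← hk1]
    exact integral_mono (hint x) hki fun y => mul_le_of_le_one_right (hk0 y) (hg1 _)
  have hηL : ∀ x y, |η x - η y| ≤ 4 / t * dist x y := fun x y => by
    rw [hη, hη, ← integral_sub (hint x) (hint y), ← Real.norm_eq_abs]
    refine (norm_integral_le_of_norm_le (hki.mul_const (4 / t * dist x y))
      (.of_forall fun z => ?_)).trans (le_of_eq ?_)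
    · rw [← mul_sub, norm_mul, Real.norm_of_nonneg (hk0 z), Real.norm_eq_abs]
      have := hgL (x - z) (y - z)
      rw [dist_sub_right] at this
      exact mul_le_mul_of_nonneg_left this (hk0 z)
    · rw [integral_mul_const, hk1, one_mul]
  have hfd : ∀ x, ‖fderiv ℝ η x‖ ≤ 4 / t := fun x => by
    have hL : LipschitzWith (Real.toNNReal (4 / t)) η := LipschitzWith.of_dist_le_mul fun x y => by
      rw [Real.dist_eq, Real.coe_toNNReal _ (by positivity)]; exact hηL x y
    have := norm_fderiv_le_of_lipschitz ℝ hL (x₀ := x)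
    rwa [Real.coe_toNNReal _ (by positivity)] at this
  have hη0 : ∀ x, δ x ≤ t / 4 → η x = 0 := fun x hx => by
    have h0 : ∀ y, dist y x < t / 4 → g y = 0 := fun y hy => by
      have h1 : δ y ≤ t / 2 := by linarith [hδL y x]
      have h2 : 4 / t * δ y - 2 ≤ 0 := by
        rw [sub_nonpos, div_mul_eq_mul_div, div_le_iff₀ ht]; linarith
      exact max_eq_left ((min_le_right _ _).trans h2)
    have hx0 : g x = 0 := h0 x (by rw [dist_self]; positivity)
    have := ρ.normed_convolution_eq_right (μ := volume) (g := g) (x₀ := x)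
      fun y hy => by rw [h0 y hy, hx0]
    exact this.trans hx0
  have hη1 : ∀ x, t ≤ δ x → η x = 1 := fun x hx => by
    have h0 : ∀ y, dist y x < t / 4 → g y = 1 := fun y hy => by
      have h1 : 3 * t / 4 ≤ δ y := by linarith [hδL x y, dist_comm x y]
      have h2 : 1 ≤ 4 / t * δ y - 2 := by
        rw [le_sub_iff_add_le, div_mul_eq_mul_div, le_div_iff₀ ht]; linarith
      change max 0 (min 1 (4 / t * δ y - 2)) = 1
      rw [min_eq_left h2, max_eq_right zero_le_one]
    have hx0 : g x = 1 := h0 x (by rw [dist_self]; positivity)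
    have := ρ.normed_convolution_eq_right (μ := volume) (g := g) (x₀ := x)
      fun y hy => by rw [h0 y hy, hx0]
    exact this.trans hx0
  let S : Set Plane := {x | t / 4 ≤ δ x}
  have hSc : IsClosed S := isClosed_le continuous_const (Metric.continuous_infDist_pt _)
  have hSΩ : S ⊆ Ω := fun x hx => by
    by_contra hxΩ
    have h1 : δ x = 0 := Metric.infDist_zero_of_mem hxΩ
    have h2 : t / 4 ≤ δ x := hx
    linarith
  have hts : tsupport η ⊆ S := closure_minimal (fun x hx => by
    by_contra h
    exact hx (hη0 x (not_le.1 h).le)) hSc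
  have hcpt : IsCompact S := Metric.isCompact_of_isClosed_isBounded hSc (hb.subset hSΩ)
  refine ⟨η, hsm, hcpt.of_isClosed_subset (isClosed_tsupport _) hts, hts.trans hSΩ, hηb, hfd,
    fun x hx hxt => ?_⟩
  -- For points of Ω the distance to the complement is attained on the frontier, so being outside
  -- the t-neighbourhood of the frontier means δ ≥ t.
  obtain ⟨y, hy, hxy⟩ := exists_mem_frontier_infDist_compl_eq_dist hx huniv
  have hδx : t ≤ δ x := by
    by_contra h
    refine hxt (Metric.mem_thickening_iff.2 ⟨y, hy, ?_⟩)
    rw [← hxy]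
    exact not_le.1 h
  -- The gradient vanishes because η attains its maximum 1 there; this also covers points at
  -- distance exactly t, where η need not be locally constant.
  refine ⟨hη1 x hδx, IsLocalMax.fderiv_eq_zero (Filter.Eventually.of_forall fun y => ?_)⟩
  rw [hη1 x hδx]
  exact (hηb y).2

/-- Smooth cutoffs in the thickness variable exhausting `(0, t)`. -/
def vcut (t : ℝ) (n : ℕ) (z : ℝ) : ℝ :=
  Real.smoothTransition ((n + 1) * z - 1) * Real.smoothTransition ((n + 1) * (t - z) - 1)

theorem contDiff_vcut (t : ℝ) (n : ℕ) : ContDiff ℝ ∞ (vcut t n) :=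
  (Real.smoothTransition.contDiff.comp (by fun_prop)).mul
    (Real.smoothTransition.contDiff.comp (by fun_prop))

theorem abs_vcut_le (t : ℝ) (n : ℕ) (z : ℝ) : |vcut t n z| ≤ 1 := by
  rw [vcut, abs_mul, abs_of_nonneg (Real.smoothTransition.nonneg _),
    abs_of_nonneg (Real.smoothTransition.nonneg _)]
  exact mul_le_one₀ (Real.smoothTransition.le_one _) (Real.smoothTransition.nonneg _)
    (Real.smoothTransition.le_one _)

theorem vcut_eq_zero {t : ℝ} {n : ℕ} {z : ℝ}
    (hz : z ∉ Icc ((n + 1 : ℝ)⁻¹) (t - (n + 1 : ℝ)⁻¹)) : vcut t n z = 0 := by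
  have hn : (0 : ℝ) < n + 1 := by positivity
  rw [mem_Icc, not_and_or, not_le, not_le] at hz
  rcases hz with hz | hz
  · rw [vcut, Real.smoothTransition.zero_of_nonpos, zero_mul]
    have := mul_lt_mul_of_pos_left hz hn
    rw [mul_inv_cancel₀ hn.ne'] at this
    linarith
  · rw [vcut, Real.smoothTransition.zero_of_nonpos (x := (n + 1) * (t - z) - 1), mul_zero]
    have := mul_lt_mul_of_pos_left (show t - z < (n + 1 : ℝ)⁻¹ by linarith) hn
    rw [mul_inv_cancel₀ hn.ne'] at this
    linarith

theorem tendsto_vcut {t z : ℝ} (hz : z ∈ Ioo 0 t) :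
    Filter.Tendsto (fun n => vcut t n z) Filter.atTop (𝓝 1) := by
  have h1 : ∀ c : ℝ, 0 < c → ∀ᶠ n : ℕ in Filter.atTop, 1 ≤ (n + 1) * c - 1 := fun c hc => by
    filter_upwards [Filter.eventually_ge_atTop ⌈2 / c⌉₊] with n hn
    have h2 : 2 / c ≤ n := (Nat.le_ceil _).trans (by exact_mod_cast hn)
    rw [div_le_iff₀ hc] at h2
    linarith
  refine tendsto_const_nhds.congr' ?_
  filter_upwards [h1 z hz.1, h1 (t - z) (sub_pos.2 hz.2)] with n h2 h3
  rw [vcut, Real.smoothTransition.one_of_one_le h2, Real.smoothTransition.one_of_one_le h3, mul_one]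

/-! ### Horizontal derivatives of the thickness average -/

theorem memLp_bdd_mul {X : Type*} [MeasurableSpace X] {μ : Measure X} {f h : X → ℝ} {c : ℝ}
    (hf : MemLp f 2 μ) (hh : AEStronglyMeasurable h μ) (hc : ∀ x, ‖h x‖ ≤ c) :
    MemLp (fun x => h x * f x) 2 μ :=
  hf.of_le_mul (hh.mul hf.aestronglyMeasurable) (.of_forall fun x => by
    rw [norm_mul]; exact mul_le_mul_of_nonneg_right (hc x) (norm_nonneg _))

section Horizontal

variable {Ω : Set Plane} {t : ℝ} {f g : Plane × ℝ → ℝ} [IsFiniteMeasure (volume.restrict Ω)]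

omit [IsFiniteMeasure (volume.restrict Ω)] in
/-- Horizontal derivatives may be tested against functions that do not depend on the height. -/
theorem HasFilmDeriv.integral_horizontal {v : Plane}
    (hf : MemLp f 2 (film Ω t)) (hg : MemLp g 2 (film Ω t)) (h : HasFilmDeriv Ω t (v, 0) f g)
    {θ : Plane → ℝ} (hθ : ContDiff ℝ ∞ θ) (hc : HasCompactSupport θ) (hs : tsupport θ ⊆ Ω) :
    ∫ p, fderiv ℝ θ p.1 v * f p ∂film Ω t = -∫ p, θ p.1 * g p ∂film Ω t := by
  -- A horizontal derivative does not fall on the vertical cutoff, so no derivative of `vcut`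
  -- appears and the limit follows by dominated convergence.
  let φ : ℕ → Plane × ℝ → ℝ := fun n p => θ p.1 * vcut t n p.2
  have hφ : ∀ n, IsFilmTest (Ω ×ˢ Ioo 0 t) (φ n) := fun n => by
    let S : Set (Plane × ℝ) := tsupport θ ×ˢ Icc ((n + 1 : ℝ)⁻¹) (t - (n + 1 : ℝ)⁻¹)
    have hS : IsCompact S := hc.isCompact.prod isCompact_Icc
    have hn : (0 : ℝ) < (n + 1 : ℝ)⁻¹ := by positivity
    have hSU : S ⊆ Ω ×ˢ Ioo 0 t := fun p hp =>
      ⟨hs hp.1, hn.trans_le hp.2.1, hp.2.2.trans_lt (by linarith)⟩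
    have hzero : ∀ p ∉ S, φ n p = 0 := fun p hp => by
      by_cases h1 : p.1 ∈ tsupport θ
      · simp only [φ, vcut_eq_zero fun h2 => hp ⟨h1, h2⟩, mul_zero]
      · simp only [φ, image_eq_zero_of_notMem_tsupport h1, zero_mul]
    have hsub : tsupport (φ n) ⊆ S :=
      closure_minimal (fun p hp => by_contra fun h => hp (hzero p h)) hS.isClosed
    exact ⟨(hθ.comp contDiff_fst).mul ((contDiff_vcut t n).comp contDiff_snd),
      HasCompactSupport.intro hS hzero, hsub.trans hSU⟩
  have hd : ∀ n p, fderiv ℝ (φ n) p (v, 0) = fderiv ℝ θ p.1 v * vcut t n p.2 := fun n p => by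
    have h1 : HasFDerivAt (fun p : Plane × ℝ => θ p.1)
        ((fderiv ℝ θ p.1).comp (ContinuousLinearMap.fst ℝ Plane ℝ)) p :=
      ((hθ.differentiable (by simp)) p.1).hasFDerivAt.comp p hasFDerivAt_fst
    have h2 : HasFDerivAt (fun p : Plane × ℝ => vcut t n p.2)
        ((fderiv ℝ (vcut t n) p.2).comp (ContinuousLinearMap.snd ℝ Plane ℝ)) p :=
      (((contDiff_vcut t n).differentiable (by simp)) p.2).hasFDerivAt.comp p hasFDerivAt_snd
    rw [show φ n = (fun p : Plane × ℝ => θ p.1) * fun p => vcut t n p.2 from rfl,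
      (h1.mul h2).fderiv]
    simp [mul_comm]
  have hlim : ∀ᵐ p ∂film Ω t, Filter.Tendsto (fun n => vcut t n p.2) Filter.atTop (𝓝 1) := by
    have h1 : ∀ᵐ z ∂thick t,
        Filter.Tendsto (fun n => vcut t n z) Filter.atTop (𝓝 1) := by
      rw [thick, ← restrict_Ioo_eq_restrict_Icc]
      filter_upwards [ae_restrict_mem measurableSet_Ioo] with z hz using tendsto_vcut hz
    exact Measure.quasiMeasurePreserving_snd.ae h1
  have lim : ∀ (a : Plane → ℝ) (k : Plane × ℝ → ℝ), Continuous a → HasCompactSupport a →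
      MemLp k 2 (film Ω t) → Filter.Tendsto
        (fun n => ∫ p, a p.1 * vcut t n p.2 * k p ∂film Ω t) Filter.atTop
        (𝓝 (∫ p, a p.1 * k p ∂film Ω t)) := fun a k ha hac hk => by
    have ham : MemLp a 2 (volume.restrict Ω) := ha.memLp_of_hasCompactSupport hac
    have hi : Integrable (fun p => a p.1 * k p) (film Ω t) :=
      integrable_mul_of_memLp (ham.comp_fst _) hk
    refine tendsto_integral_of_dominated_convergence (fun p => ‖a p.1 * k p‖) (fun n => ?_)
      hi.norm (fun n => .of_forall fun p => ?_) ?_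
    · have : Continuous fun p : Plane × ℝ => a p.1 * vcut t n p.2 :=
        (ha.comp continuous_fst).mul ((contDiff_vcut t n).continuous.comp continuous_snd)
      exact this.aestronglyMeasurable.mul hk.aestronglyMeasurable
    · rw [norm_mul, norm_mul, norm_mul]
      exact mul_le_mul_of_nonneg_right (mul_le_of_le_one_right (norm_nonneg _) (abs_vcut_le t n _))
        (norm_nonneg _)
    · filter_upwards [hlim] with p hp
      simpa using (hp.const_mul (a p.1)).mul_const (k p)
  have l1 := lim (fun x => fderiv ℝ θ x v) f
    ((hθ.continuous_fderiv (by simp)).clm_apply continuous_const) (hc.fderiv_apply ℝ v) hf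
  have l2 := lim θ g hθ.continuous hc hg
  refine tendsto_nhds_unique l1 (l2.neg.congr fun n => ?_)
  rw [← h _ (hφ n)]
  simp only [hd]

omit [IsFiniteMeasure (volume.restrict Ω)] in
/-- The average over the thickness inherits weak horizontal derivatives. -/
theorem HasFilmDeriv.integral_vmean {v : Plane}
    (hf : MemLp f 2 (film Ω t)) (hg : MemLp g 2 (film Ω t)) (h : HasFilmDeriv Ω t (v, 0) f g)
    {θ : Plane → ℝ} (hθ : ContDiff ℝ ∞ θ) (hc : HasCompactSupport θ) (hs : tsupport θ ⊆ Ω) :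
    ∫ x in Ω, fderiv ℝ θ x v * vmean t f x = -∫ x in Ω, θ x * vmean t g x := by
  have h1 := h.integral_horizontal hf hg hθ hc hs
  have hθm : MemLp θ 2 (volume.restrict Ω) := hθ.continuous.memLp_of_hasCompactSupport hc
  have hθm' : MemLp (fun x => fderiv ℝ θ x v) 2 (volume.restrict Ω) :=
    ((hθ.continuous_fderiv (by simp)).clm_apply continuous_const).memLp_of_hasCompactSupport
      (hc.fderiv_apply ℝ v)
  rw [integral_prod _ (integrable_mul_of_memLp (hθm'.comp_fst _) hf),
    integral_prod _ (integrable_mul_of_memLp (hθm.comp_fst _) hg)] at h1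
  simp only [integral_const_mul] at h1
  simp only [vmean, mul_left_comm _ t⁻¹]
  rw [integral_const_mul, integral_const_mul, h1]
  ring

/-- The weak horizontal derivative of the truncated thickness average. -/
theorem HasFilmDeriv.integral_cutoff_vmean {v : Plane} (ht : 0 < t)
    (hf : MemLp f 2 (film Ω t)) (hg : MemLp g 2 (film Ω t)) (h : HasFilmDeriv Ω t (v, 0) f g)
    {η : Plane → ℝ} (hη : ContDiff ℝ ∞ η) (hc : HasCompactSupport η) (hs : tsupport η ⊆ Ω)
    {φ : Plane × ℝ → ℝ} (hφ : IsFilmTest univ φ) :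
    ∫ p, fderiv ℝ φ p (v, 0) * (η p.1 * vmean t f p.1) ∂film Ω t =
      -∫ p, φ p * (η p.1 * vmean t g p.1 + fderiv ℝ η p.1 v * vmean t f p.1) ∂film Ω t := by
  have hvf := memLp_vmean ht hf
  have hvg := memLp_vmean ht hg
  obtain ⟨C, hC⟩ := hc.exists_bound_of_continuous hη.continuous
  have hηc : Continuous fun x => fderiv ℝ η x v :=
    (hη.continuous_fderiv (by simp)).clm_apply continuous_const
  obtain ⟨C', hC'⟩ := (hc.fderiv_apply ℝ v).exists_bound_of_continuous hηc
  have m1 : MemLp (fun x => η x * vmean t f x) 2 (volume.restrict Ω) :=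
    memLp_bdd_mul hvf hη.continuous.aestronglyMeasurable hC
  have m2 : MemLp (fun x => η x * vmean t g x) 2 (volume.restrict Ω) :=
    memLp_bdd_mul hvg hη.continuous.aestronglyMeasurable hC
  have m3 : MemLp (fun x => fderiv ℝ η x v * vmean t f x) 2 (volume.restrict Ω) :=
    memLp_bdd_mul hvf hηc.aestronglyMeasurable hC'
  have m23 : MemLp (fun x => η x * vmean t g x + fderiv ℝ η x v * vmean t f x) 2
      (volume.restrict Ω) := m2.add m3
  -- The identity is proved on each horizontal slice, where φ need not vanish at the top or bottom.
  -- There η φ(·, s) is supported in Ω and is an admissible test function for the average.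
  rw [integral_prod_symm _ (integrable_mul_of_memLp (hφ.memLp_fderiv _ _) (m1.comp_fst _)),
    integral_prod_symm _ (integrable_mul_of_memLp (hφ.memLp _) (m23.comp_fst _)), ← integral_neg]
  refine integral_congr_ae (.of_forall fun s => ?_)
  simp only
  have hφs : ContDiff ℝ ∞ fun x => φ (x, s) := hφ.smooth.comp (by fun_prop)
  have hφsc : HasCompactSupport fun x => φ (x, s) :=
    HasCompactSupport.intro (hφ.compact.isCompact.image continuous_fst) fun x hx =>
      image_eq_zero_of_notMem_tsupport fun hp => hx ⟨_, hp, rfl⟩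
  have hφs' : ∀ x, fderiv ℝ (fun x => φ (x, s)) x v = fderiv ℝ φ (x, s) (v, 0) := fun x => by
    have h1 : HasFDerivAt (fun x : Plane => (x, s))
        (ContinuousLinearMap.inl ℝ Plane ℝ) x := hasFDerivAt_prodMk_left x s
    have h2 := ((hφ.smooth.differentiable (by simp)) (x, s)).hasFDerivAt.comp x h1
    rw [show (fun x => φ (x, s)) = φ ∘ fun x => (x, s) from rfl, h2.fderiv]
    simp
  have k1 : MemLp (fun x => φ (x, s)) 2 (volume.restrict Ω) :=
    hφs.continuous.memLp_of_hasCompactSupport hφsc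
  have k2 : MemLp (fun x => fderiv ℝ φ (x, s) (v, 0)) 2 (volume.restrict Ω) := by
    simp only [← hφs']
    exact ((hφs.continuous_fderiv (by simp)).clm_apply
      continuous_const).memLp_of_hasCompactSupport (hφsc.fderiv_apply ℝ v)
  have hθ' : ∀ x, fderiv ℝ (fun x => η x * φ (x, s)) x v =
      η x * fderiv ℝ φ (x, s) (v, 0) + fderiv ℝ η x v * φ (x, s) := fun x => by
    have := ((hη.differentiable (by simp)) x).hasFDerivAt.mul
      ((hφs.differentiable (by simp)) x).hasFDerivAt
    rw [show (fun x => η x * φ (x, s)) = η * fun x => φ (x, s) from rfl, this.fderiv, ← hφs']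
    simp [mul_comm]
  have key := h.integral_vmean hf hg (θ := fun x => η x * φ (x, s)) (hη.mul hφs) hc.mul_right
    ((tsupport_mul_subset_left).trans hs)
  simp only [hθ', add_mul] at key
  have j1 := integrable_mul_of_memLp k2 m1
  have j2 := integrable_mul_of_memLp k1 m2
  have j3 := integrable_mul_of_memLp k1 m3
  have e1 : ∀ x, η x * fderiv ℝ φ (x, s) (v, 0) * vmean t f x =
      fderiv ℝ φ (x, s) (v, 0) * (η x * vmean t f x) := fun x => by ring
  have e2 : ∀ x, η x * φ (x, s) * vmean t g x = φ (x, s) * (η x * vmean t g x) := fun x => by ring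
  have e3 : ∀ x, fderiv ℝ η x v * φ (x, s) * vmean t f x =
      φ (x, s) * (fderiv ℝ η x v * vmean t f x) := fun x => by ring
  simp only [e1, e2, e3] at key
  rw [integral_add j1 j3] at key
  simp only [mul_add]
  rw [integral_add j2 j3]
  linarith

/-- The primitive of a function with vanishing vertical mean has that function as its weak
vertical derivative in the whole space. -/
theorem integral_fderiv_mul_vprim (hf : MemLp f 2 (film Ω t)) (ht : 0 < t)
    (h0 : ∀ᵐ x ∂volume.restrict Ω, ∫ z, f (x, z) ∂thick t = 0)
    {φ : Plane × ℝ → ℝ} (hφ : IsFilmTest univ φ) :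
    ∫ p, fderiv ℝ φ p (0, 1) * vprim t f p ∂film Ω t = -∫ p, φ p * f p ∂film Ω t := by
  rw [integral_prod _ (integrable_mul_of_memLp (hφ.memLp_fderiv _ _) (memLp_vprim ht hf)),
    integral_prod _ (integrable_mul_of_memLp (hφ.memLp _) hf), ← integral_neg]
  refine integral_congr_ae ?_
  filter_upwards [ae_memLp_slice hf, h0] with x hx hx0
  have hd : ∀ z, HasDerivAt (fun z => φ (x, z)) (fderiv ℝ φ (x, z) (0, 1)) z := fun z => by
    have h1 : HasDerivAt (fun z : ℝ => (x, z)) (0, 1) z :=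
      (hasDerivAt_const z x).prodMk (hasDerivAt_id z)
    exact ((hφ.smooth.differentiable (by simp)) (x, z)).hasFDerivAt.comp_hasDerivAt z h1
  have hc : Continuous fun z => fderiv ℝ φ (x, z) (0, 1) :=
    ((hφ.smooth.continuous_fderiv (by simp)).comp (by fun_prop)).clm_apply continuous_const
  have h1 := integral_primitive_mul_deriv (hx.integrable (by norm_num)) hd hc
  -- Zero vertical mean makes the primitive vanish at the top, which removes the only boundary term
  -- although φ is unrestricted there.
  rw [hx0, mul_zero, zero_sub] at h1
  rw [← h1]
  refine integral_congr_ae (.of_forall fun z => ?_)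
  simp only [vprim, mul_comm]

end Horizontal

/-! ### Passage between ℝ³ and ℝ² × ℝ, and extension by zero -/

/-- The splitting `ℝ³ = ℝ² × ℝ`. -/
def coords : Space ≃L[ℝ] Plane × ℝ :=
  LinearEquiv.toContinuousLinearEquiv
    { toFun := fun p => (inPlane p, p 2)
      invFun := fun q => !₂[q.1 0, q.1 1, q.2]
      map_add' := fun p q => by
        refine Prod.ext (PiLp.ext fun i => ?_) rfl
        fin_cases i <;> simp [inPlane]
      map_smul' := fun c p => by
        refine Prod.ext (PiLp.ext fun i => ?_) rfl
        fin_cases i <;> simp [inPlane]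
      left_inv := fun p => by
        refine PiLp.ext fun i => ?_
        fin_cases i <;> simp [inPlane]
      right_inv := fun q => by
        refine Prod.ext (PiLp.ext fun i => ?_) ?_
        · fin_cases i <;> simp [inPlane]
        · simp }

theorem coords_apply (p : Space) : coords p = (inPlane p, p 2) := rfl

theorem coords_symm_apply (q : Plane × ℝ) : coords.symm q = !₂[q.1 0, q.1 1, q.2] := rfl

theorem coords_basisVec_two : coords (basisVec 2) = (0, 1) := by
  refine Prod.ext (PiLp.ext fun i => ?_) ?_
  · fin_cases i <;> simp [coords_apply, inPlane, basisVec]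
  · simp [coords_apply, basisVec]

theorem measurePreserving_coords :
    MeasurePreserving coords (volume : Measure Space) (volume : Measure (Plane × ℝ)) := by
  have h1 := PiLp.volume_preserving_ofLp (Fin 3)
  have h2 := volume_preserving_piFinSuccAbove (fun _ : Fin 3 => ℝ) 2
  have h3 := Measure.measurePreserving_swap (μ := (volume : Measure ℝ))
    (ν := (volume : Measure (Fin 2 → ℝ)))
  have h4 := (PiLp.volume_preserving_toLp (Fin 2)).prod
    (MeasurePreserving.id (volume : Measure ℝ))
  have h := h4.comp (h3.comp (h2.comp h1))
  have he : (coords : Space → Plane × ℝ) = Prod.map (WithLp.toLp 2) id ∘ Prod.swap ∘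
      MeasurableEquiv.piFinSuccAbove (fun _ => ℝ) 2 ∘ WithLp.ofLp := by
    funext p
    refine Prod.ext (PiLp.ext fun i => ?_) rfl
    fin_cases i <;> rfl
  rw [he]
  exact h

theorem measurableEmbedding_coords : MeasurableEmbedding coords :=
  coords.toHomeomorph.measurableEmbedding

theorem preimage_coords (Ω : Set Plane) (I : Set ℝ) : coords ⁻¹' (Ω ×ˢ I) = slab Ω I := rfl

theorem measurePreserving_coords_film (Ω : Set Plane) (t : ℝ) :
    MeasurePreserving coords (volume.restrict (slab Ω (Icc 0 t))) (film Ω t) := by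
  rw [film_eq_restrict, ← preimage_coords]
  exact measurePreserving_coords.restrict_preimage_emb measurableEmbedding_coords _

theorem measurePreserving_coords_film_Ioo (Ω : Set Plane) (t : ℝ) :
    MeasurePreserving coords (volume.restrict (slab Ω (Ioo 0 t))) (film Ω t) := by
  rw [film_eq_restrict_Ioo, ← preimage_coords]
  exact measurePreserving_coords.restrict_preimage_emb measurableEmbedding_coords _

theorem measurePreserving_coords_symm_film (Ω : Set Plane) (t : ℝ) :
    MeasurePreserving coords.symm (film Ω t) (volume.restrict (slab Ω (Icc 0 t))) :=
  (measurePreserving_coords_film Ω t).symm coords.toHomeomorph.toMeasurableEquiv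

theorem measurePreserving_coords_symm_film_Ioo (Ω : Set Plane) (t : ℝ) :
    MeasurePreserving coords.symm (film Ω t) (volume.restrict (slab Ω (Ioo 0 t))) :=
  (measurePreserving_coords_film_Ioo Ω t).symm coords.toHomeomorph.toMeasurableEquiv

theorem measurableSet_slab {Ω : Set Plane} (hΩ : IsOpen Ω) {I : Set ℝ} (hI : MeasurableSet I) :
    MeasurableSet (slab Ω I) :=
  coords.continuous.measurable (hΩ.measurableSet.prod hI)

theorem isOpen_slab {Ω : Set Plane} (hΩ : IsOpen Ω) (t : ℝ) : IsOpen (slab Ω (Ioo 0 t)) :=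
  (hΩ.prod isOpen_Ioo).preimage coords.continuous

/-- The function on `ℝ³` that equals `f` in the film and vanishes outside. -/
def onSpace (Ω : Set Plane) (t : ℝ) (f : Plane × ℝ → ℝ) : Space → ℝ :=
  (slab Ω (Icc 0 t)).indicator fun p => f (coords p)

section OnSpace

variable {Ω : Set Plane} {t : ℝ} {f g : Plane × ℝ → ℝ}

theorem memLp_onSpace (hΩ : IsOpen Ω) (hf : MemLp f 2 (film Ω t)) :
    MemLp (onSpace Ω t f) 2 volume :=
  (memLp_indicator_iff_restrict (measurableSet_slab hΩ measurableSet_Icc)).2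
    (hf.comp_measurePreserving (measurePreserving_coords_film Ω t))

theorem integral_mul_onSpace (hΩ : IsOpen Ω) (h : Space → ℝ) :
    ∫ x, h x * onSpace Ω t f x = ∫ p, h (coords.symm p) * f p ∂film Ω t := by
  have h1 : ∀ x, h x * onSpace Ω t f x =
      (slab Ω (Icc 0 t)).indicator (fun x => h x * f (coords x)) x := fun x => by
    simp only [onSpace, indicator]
    split_ifs <;> simp
  simp only [h1]
  rw [integral_indicator (measurableSet_slab hΩ measurableSet_Icc),
    ← (measurePreserving_coords_film Ω t).integral_comp measurableEmbedding_coords]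
  simp

theorem integral_onSpace_sq (hΩ : IsOpen Ω) :
    ∫ x, onSpace Ω t f x ^ 2 = ∫ p, f p ^ 2 ∂film Ω t := by
  have h1 : ∀ x, onSpace Ω t f x ^ 2 =
      (slab Ω (Icc 0 t)).indicator (fun x => f (coords x) ^ 2) x := fun x => by
    simp only [onSpace, indicator]
    split_ifs <;> simp
  simp only [h1]
  rw [integral_indicator (measurableSet_slab hΩ measurableSet_Icc),
    ← (measurePreserving_coords_film Ω t).integral_comp measurableEmbedding_coords]

theorem integral_onSpace_mul (hΩ : IsOpen Ω) :
    ∫ x, onSpace Ω t f x * onSpace Ω t g x = ∫ p, f p * g p ∂film Ω t := by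
  have h1 : ∀ x, onSpace Ω t f x * onSpace Ω t g x =
      (slab Ω (Icc 0 t)).indicator (fun x => f (coords x) * g (coords x)) x := fun x => by
    simp only [onSpace, indicator]
    split_ifs <;> simp
  simp only [h1]
  rw [integral_indicator (measurableSet_slab hΩ measurableSet_Icc),
    ← (measurePreserving_coords_film Ω t).integral_comp measurableEmbedding_coords
      fun p => f p * g p]

theorem onSpace_add (x : Space) :
    onSpace Ω t (fun p => f p + g p) x = onSpace Ω t f x + onSpace Ω t g x := by
  simp only [onSpace, indicator]
  split_ifs <;> simp

theorem IsTestFunction.comp_coords_symm {φ : Space → ℝ} (hφ : IsTestFunction univ φ) :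
    IsFilmTest univ fun p => φ (coords.symm p) :=
  ⟨hφ.smooth.comp coords.symm.contDiff,
    hφ.compact.comp_homeomorph coords.symm.toHomeomorph, subset_univ _⟩

theorem fderiv_comp_coords_symm {φ : Space → ℝ} (hφ : ContDiff ℝ ∞ φ) (p : Plane × ℝ)
    (v : Space) :
    fderiv ℝ (fun p => φ (coords.symm p)) p (coords v) = fderiv ℝ φ (coords.symm p) v := by
  have := ((hφ.differentiable (by simp)) (coords.symm p)).hasFDerivAt.comp p
    coords.symm.hasFDerivAt
  rw [show (fun p => φ (coords.symm p)) = φ ∘ coords.symm from rfl, this.fderiv]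
  simp

theorem fderiv_comp_coords {φ : Plane × ℝ → ℝ} (hφ : ContDiff ℝ ∞ φ) (x : Space) (v : Space) :
    fderiv ℝ (fun x => φ (coords x)) x v = fderiv ℝ φ (coords x) (coords v) := by
  have := ((hφ.differentiable (by simp)) (coords x)).hasFDerivAt.comp x coords.hasFDerivAt
  rw [show (fun x => φ (coords x)) = φ ∘ coords from rfl, this.fderiv]
  simp

theorem IsFilmTest.comp_coords {φ : Plane × ℝ → ℝ} (hφ : IsFilmTest (Ω ×ˢ Ioo 0 t) φ) :
    IsTestFunction (slab Ω (Ioo 0 t)) fun x => φ (coords x) := by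
  refine ⟨hφ.smooth.comp coords.contDiff, hφ.compact.comp_homeomorph coords.toHomeomorph, ?_⟩
  rw [← preimage_coords]
  refine (tsupport_comp_subset_preimage φ coords.continuous).trans (preimage_mono hφ.support)

/-- Weak derivatives of functions extended by zero can be computed on the film. -/
theorem integral_fderiv_mul_onSpace (hΩ : IsOpen Ω) {v : Space}
    (h : ∀ φ, IsFilmTest univ φ →
      ∫ p, fderiv ℝ φ p (coords v) * f p ∂film Ω t = -∫ p, φ p * g p ∂film Ω t)
    {φ : Space → ℝ} (hφ : IsTestFunction univ φ) :
    ∫ x, fderiv ℝ φ x v * onSpace Ω t f x = -∫ x, φ x * onSpace Ω t g x := by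
  rw [integral_mul_onSpace hΩ, integral_mul_onSpace hΩ, ← h _ hφ.comp_coords_symm]
  simp only [fderiv_comp_coords_symm hφ.smooth]

theorem HasWeakGradientOn.hasFilmDeriv {F : Space → ℝ} {G : Space → Space}
    (h : HasWeakGradientOn (slab Ω (Ioo 0 t)) F G) (j : Fin 3) :
    HasFilmDeriv Ω t (coords (basisVec j)) (fun p => F (coords.symm p))
      fun p => G (coords.symm p) j := fun φ hφ => by
  have h1 := h.integral_eq _ hφ.comp_coords j
  rw [← (measurePreserving_coords_film_Ioo Ω t).integral_comp measurableEmbedding_coords,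
    ← (measurePreserving_coords_film_Ioo Ω t).integral_comp measurableEmbedding_coords]
  simp only [gradient_coord, fderiv_comp_coords hφ.smooth] at h1
  simp only [ContinuousLinearEquiv.symm_apply_apply, mul_comm] at h1 ⊢
  exact h1

end OnSpace

/-! ### Uniqueness of weak gradients -/

theorem integrableOn_mul_testFunction {U : Set Space} {k : Space → ℝ}
    (hk : LocallyIntegrableOn k U volume) {φ : Space → ℝ} (hφ : IsTestFunction U φ) :
    IntegrableOn (fun x => k x * φ x) U := by
  have h1 : IntegrableOn k (tsupport φ) :=
    hk.integrableOn_compact_subset hφ.support hφ.compact.isCompact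
  have h2 : IntegrableOn (fun x => k x * φ x) (tsupport φ) :=
    h1.mul_continuousOn hφ.smooth.continuous.continuousOn hφ.compact.isCompact
  refine Integrable.integrableOn ((integrableOn_iff_integrable_of_support_subset fun x hx => ?_).1 h2)
  exact subset_tsupport φ (right_ne_zero_of_mul hx)

/-- Weak gradients are unique almost everywhere. -/
theorem HasWeakGradientOn.ae_eq {U : Set Space} (hU : IsOpen U) {f : Space → ℝ}
    {G G' : Space → Space} (h : HasWeakGradientOn U f G) (h' : HasWeakGradientOn U f G') :
    G =ᵐ[volume.restrict U] G' := by
  have hc : ∀ {G : Space → Space}, LocallyIntegrableOn G U volume → ∀ j : Fin 3,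
      LocallyIntegrableOn (fun x => G x j) U volume := fun hG j x hx => by
    obtain ⟨s, hs, hi⟩ := hG x hx
    exact ⟨s, hs, (EuclideanSpace.proj j : Space →L[ℝ] ℝ).integrable_comp hi⟩
  have key : ∀ j : Fin 3, ∀ᵐ x, x ∈ U → G x j - G' x j = 0 := fun j => by
    refine hU.ae_eq_zero_of_integral_contDiff_smul_eq_zero
      ((hc h.locInt_grad j).sub (hc h'.locInt_grad j)) fun φ h1 h2 h3 => ?_
    have hφ : IsTestFunction U φ := ⟨h1, h2, h3⟩
    have e := (h.integral_eq φ hφ j).symm.trans (h'.integral_eq φ hφ j)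
    rw [neg_inj] at e
    rw [← setIntegral_eq_integral_of_forall_compl_eq_zero (s := U)]
    · simp only [smul_eq_mul, mul_comm (φ _), sub_mul]
      rw [integral_sub (integrableOn_mul_testFunction (hc h.locInt_grad j) hφ)
        (integrableOn_mul_testFunction (hc h'.locInt_grad j) hφ), e, sub_self]
    · intro x hx
      rw [image_eq_zero_of_notMem_tsupport fun h => hx (h3 h), zero_smul]
  rw [Filter.EventuallyEq, ae_restrict_iff' hU.measurableSet]
  filter_upwards [ae_all_iff.2 key] with x hx hxU
  exact PiLp.ext fun j => sub_eq_zero.1 (hx j hxU)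

/-! ### Admissible fields and their thickness averages -/

section Film

variable {Ω : Set Plane} {t : ℝ} {M : Space → Space}

theorem withHeight_eq (p : Space) (z : ℝ) : withHeight p z = coords.symm (inPlane p, z) := by
  refine PiLp.ext fun i => ?_
  fin_cases i <;> simp [withHeight, coords_symm_apply, inPlane]

/-- A vector field on `ℝ³` supported in the film has a stray field. -/
theorem exists_isStrayField_of_onSpace [IsFiniteMeasure (volume.restrict Ω)] (hΩ : IsOpen Ω)
    {N : Space → Space} {f : Fin 3 → Plane × ℝ → ℝ} (hf : ∀ j, MemLp (f j) 2 (film Ω t))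
    (hN : ∀ j, (fun x => N x j) =ᵐ[volume] onSpace Ω t (f j)) :
    MemLp N 2 volume ∧ ∃ H, IsStrayField N H := by
  have h2 : MemLp N 2 volume :=
    MemLp.of_eval_piLp fun j => (memLp_onSpace hΩ (hf j)).ae_eq (hN j).symm
  refine ⟨h2, exists_isStrayField h2 (Integrable.of_eval_piLp fun j => ?_)⟩
  refine Integrable.congr ?_ (hN j).symm
  exact (integrable_indicator_iff (measurableSet_slab hΩ measurableSet_Icc)).2
    ((measurePreserving_coords_film Ω t).integrable_comp_of_integrable
      ((hf j).integrable (by norm_num)))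

theorem memLp_component (hM : MemLp M 2 volume) (j : Fin 3) :
    MemLp (fun p => M (coords.symm p) j) 2 (film Ω t) :=
  ((MemLp.coord hM j).restrict _).comp_measurePreserving (measurePreserving_coords_symm_film Ω t)

theorem ae_eq_onSpace (h : ∀ᵐ x, x ∉ slab Ω (Icc 0 t) → M x = 0) (j : Fin 3) :
    (fun x => M x j) =ᵐ[volume] onSpace Ω t fun p => M (coords.symm p) j := by
  filter_upwards [h] with x hx
  simp only [onSpace, indicator, ContinuousLinearEquiv.symm_apply_apply]
  split_ifs with hs
  · rfl
  · rw [hx hs]; rfl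

/-- Over almost every x in Ω the vertical slice is integrable, so taking a component commutes with
the average. Over almost every x outside Ω the slice vanishes almost everywhere, and so does the
average. -/
theorem thicknessAverage_ae_eq [IsFiniteMeasure (volume.restrict Ω)] (hΩ : IsOpen Ω)
    (hM : MemLp M 2 volume) (h : ∀ᵐ x, x ∉ slab Ω (Icc 0 t) → M x = 0) (j : Fin 3) :
    (fun x => thicknessAverage t M x j) =ᵐ[volume]
      onSpace Ω t fun p => vmean t (fun p => M (coords.symm p) j) p.1 := by
  let A : Plane → Space := fun x => t⁻¹ • ∫ z in Icc 0 t, M (coords.symm (x, z))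
  have hA1 : ∀ᵐ x : Plane, x ∈ Ω → A x j = vmean t (fun p => M (coords.symm p) j) x := by
    have hi : Integrable (fun p => M (coords.symm p)) (film Ω t) :=
      ((hM.restrict _).comp_measurePreserving
        (measurePreserving_coords_symm_film Ω t)).integrable (by norm_num)
    rw [← ae_restrict_iff' hΩ.measurableSet]
    filter_upwards [hi.prod_right_ae] with x hx
    have : ∫ z, M (coords.symm (x, z)) j ∂thick t = (∫ z, M (coords.symm (x, z)) ∂thick t) j :=
      (EuclideanSpace.proj j : Space →L[ℝ] ℝ).integral_comp_comm hx
    simp only [A, vmean, PiLp.smul_apply, smul_eq_mul]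
    rw [← this]
  have hA2 : ∀ᵐ x : Plane, x ∉ Ω → A x = 0 := by
    have hs : MeasurePreserving coords.symm (volume : Measure (Plane × ℝ)) volume :=
      measurePreserving_coords.symm coords.toHomeomorph.toMeasurableEquiv
    have h1 := Measure.ae_ae_of_ae_prod (hs.quasiMeasurePreserving.ae h)
    filter_upwards [h1] with x hx hxΩ
    have h2 : ∫ z in Icc 0 t, M (coords.symm (x, z)) = 0 := by
      refine integral_eq_zero_of_ae (ae_restrict_of_ae ?_)
      filter_upwards [hx] with z hz
      refine hz fun hm => hxΩ ?_
      have h3 : coords (coords.symm (x, z)) ∈ Ω ×ˢ Icc 0 t := hm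
      rw [ContinuousLinearEquiv.apply_symm_apply] at h3
      exact h3.1
    simp only [A, h2, smul_zero]
  have hq : Measure.QuasiMeasurePreserving (fun x : Space => (coords x).1) volume volume :=
    Measure.quasiMeasurePreserving_fst.comp measurePreserving_coords.quasiMeasurePreserving
  filter_upwards [hq.ae hA1, hq.ae hA2] with x h1 h2
  have e : thicknessAverage t M x = (Icc (0 : ℝ) t).indicator (fun _ => A (inPlane x)) (x 2) := by
    simp only [thicknessAverage, withHeight_eq, A]
  rw [e]
  by_cases hz : x 2 ∈ Icc (0 : ℝ) t
  · rw [indicator_of_mem hz]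
    by_cases hx : inPlane x ∈ Ω
    · rw [onSpace, indicator_of_mem (show x ∈ slab Ω (Icc 0 t) from ⟨hx, hz⟩)]
      exact h1 hx
    · rw [onSpace, indicator_of_notMem (fun hs : x ∈ slab Ω (Icc 0 t) => hx hs.1),
        show A (inPlane x) = 0 from h2 hx]
      rfl
  · rw [indicator_of_notMem hz, onSpace,
      indicator_of_notMem (fun hs : x ∈ slab Ω (Icc 0 t) => hz hs.2)]
    rfl

theorem ae_abs_vmean_le (ht : 0 < t) {f : Plane × ℝ → ℝ} {c : ℝ}
    (hf : ∀ᵐ p ∂film Ω t, |f p| ≤ c) : ∀ᵐ x ∂volume.restrict Ω, |vmean t f x| ≤ c := by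
  filter_upwards [Measure.ae_ae_of_ae_prod hf] with x hx
  have h1 := norm_integral_le_of_norm_le_const (f := fun z => f (x, z)) hx
  rw [thick_real_univ ht, Real.norm_eq_abs] at h1
  rw [vmean, abs_mul, abs_of_pos (inv_pos.2 ht), inv_mul_le_iff₀ ht, mul_comm]
  exact h1

theorem ae_abs_component_le (hΩ : IsOpen Ω) (h : ∀ᵐ x, x ∈ slab Ω (Icc 0 t) → ‖M x‖ = 1)
    (j : Fin 3) : ∀ᵐ p ∂film Ω t, |M (coords.symm p) j| ≤ 1 := by
  have h1 : ∀ᵐ x ∂volume.restrict (slab Ω (Icc 0 t)), ‖M x‖ = 1 :=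
    (ae_restrict_iff' (measurableSet_slab hΩ measurableSet_Icc)).2 h
  filter_upwards [(measurePreserving_coords_symm_film Ω t).quasiMeasurePreserving.ae h1] with p hp
  rw [← hp, ← Real.norm_eq_abs]
  exact PiLp.norm_apply_le _ _

/-- A horizontal function of size at most `c` concentrated on `S` contributes at most
`c² t |S ∩ Ω|` to the energy. -/
theorem integral_horizontal_sq_le [IsFiniteMeasure (volume.restrict Ω)] (ht : 0 < t)
    {u : Plane → ℝ} (hu : MemLp u 2 (volume.restrict Ω)) {S : Set Plane} (hS : MeasurableSet S)
    {c : ℝ} (hc : ∀ᵐ x ∂volume.restrict Ω, |u x| ≤ c)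
    (h0 : ∀ᵐ x ∂volume.restrict Ω, x ∉ S → u x = 0) :
    ∫ p, u p.1 ^ 2 ∂film Ω t ≤ c ^ 2 * (t * (volume (S ∩ Ω)).toReal) := by
  have h1 : ∫ p, u p.1 ^ 2 ∂film Ω t = t * ∫ x in Ω, u x ^ 2 := by
    rw [integral_prod _ (hu.integrable_sq.comp_fst (thick t))]
    simp only [integral_thick_const ht, integral_const_mul]
  have h2 : ∫ x in Ω, u x ^ 2 ≤ ∫ x in Ω, S.indicator (fun _ => c ^ 2) x := by
    refine integral_mono_ae hu.integrable_sq ((integrable_const _).indicator hS) ?_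
    filter_upwards [hc, h0] with x hx hx0
    by_cases hxS : x ∈ S
    · rw [indicator_of_mem hxS, ← sq_abs]
      exact pow_le_pow_left₀ (abs_nonneg _) hx 2
    · rw [indicator_of_notMem hxS, hx0 hxS]
      simp
  rw [integral_indicator hS, integral_const, measureReal_restrict_apply MeasurableSet.univ,
    univ_inter, measureReal_restrict_apply hS, smul_eq_mul] at h2
  rw [h1]
  calc t * ∫ x in Ω, u x ^ 2 ≤ t * (volume.real (S ∩ Ω) * c ^ 2) := by gcongr
    _ = c ^ 2 * (t * (volume (S ∩ Ω)).toReal) := by rw [Measure.real]; ring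

end Film

/-! ### Assembling the energy estimate -/

theorem coords_basisVec {i : Fin 3} (hi : i ≠ 2) :
    coords (basisVec i) = (inPlane (basisVec i), 0) := by
  rw [coords_apply]
  simp [basisVec, hi.symm]

theorem norm_inPlane_le (p : Space) : ‖inPlane p‖ ≤ ‖p‖ := by
  refine le_of_sq_le_sq ?_ (norm_nonneg _)
  rw [norm_sq_eq_sum, EuclideanSpace.norm_sq_eq, Fin.sum_univ_two, Fin.sum_univ_three]
  simp only [inPlane, Real.norm_eq_abs, sq_abs]
  exact le_add_of_nonneg_right (sq_nonneg (p 2))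

section Energy

variable {Ω : Set Plane} {t : ℝ} [IsFiniteMeasure (volume.restrict Ω)]

/-- `L²` bound for a weak derivative of the truncated thickness average. -/
theorem integral_cutoff_deriv_sq_le (ht : 0 < t) {f g : Plane × ℝ → ℝ}
    (hf : MemLp f 2 (film Ω t)) (hg : MemLp g 2 (film Ω t)) {η ζ : Plane → ℝ}
    (hη : Continuous η) (hζ : Continuous ζ) (hη1 : ∀ x, |η x| ≤ 1) {c : ℝ} (hζc : ∀ x, |ζ x| ≤ c)
    (hb : ∀ᵐ p ∂film Ω t, |f p| ≤ 1) {S : Set Plane} (hS : MeasurableSet S)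
    (h0 : ∀ x ∈ Ω, x ∉ S → ζ x = 0) (hΩ : MeasurableSet Ω) :
    MemLp (fun p : Plane × ℝ => η p.1 * vmean t g p.1 + ζ p.1 * vmean t f p.1) 2 (film Ω t) ∧
    ∫ p, (η p.1 * vmean t g p.1 + ζ p.1 * vmean t f p.1) ^ 2 ∂film Ω t ≤
      2 * (∫ p, g p ^ 2 ∂film Ω t) + 2 * (c ^ 2 * (t * (volume (S ∩ Ω)).toReal)) := by
  have hvf := memLp_vmean ht hf
  have hvg := memLp_vmean ht hg
  have m1 : MemLp (fun x => η x * vmean t g x) 2 (volume.restrict Ω) :=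
    memLp_bdd_mul hvg hη.aestronglyMeasurable hη1
  have m2 : MemLp (fun x => ζ x * vmean t f x) 2 (volume.restrict Ω) :=
    memLp_bdd_mul hvf hζ.aestronglyMeasurable hζc
  have m : MemLp (fun p : Plane × ℝ => η p.1 * vmean t g p.1 + ζ p.1 * vmean t f p.1) 2
      (film Ω t) := (m1.comp_fst (thick t)).add (m2.comp_fst (thick t))
  refine ⟨m, ?_⟩
  have b1 : ∫ p, (ζ p.1 * vmean t f p.1) ^ 2 ∂film Ω t ≤
      c ^ 2 * (t * (volume (S ∩ Ω)).toReal) := by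
    refine integral_horizontal_sq_le ht m2 hS ?_ ?_
    · filter_upwards [ae_abs_vmean_le ht hb] with x hx
      rw [abs_mul]
      exact (mul_le_of_le_one_right (abs_nonneg _) hx).trans (hζc x)
    · filter_upwards [ae_restrict_mem hΩ] with x hx hxS
      rw [h0 x hx hxS, zero_mul]
  have b2 := integral_vmean_sq_le ht hg
  have i2 := (m2.comp_fst (thick t)).integrable_sq
  have i3 := (hvg.comp_fst (thick t)).integrable_sq
  have b3 : ∫ p, (η p.1 * vmean t g p.1 + ζ p.1 * vmean t f p.1) ^ 2 ∂film Ω t ≤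
      ∫ p, (2 * vmean t g p.1 ^ 2 + 2 * (ζ p.1 * vmean t f p.1) ^ 2) ∂film Ω t := by
    refine integral_mono m.integrable_sq ((i3.const_mul 2).add (i2.const_mul 2)) fun p => ?_
    have h1 : (η p.1 * vmean t g p.1) ^ 2 ≤ vmean t g p.1 ^ 2 := by
      rw [mul_pow]
      exact mul_le_of_le_one_left (sq_nonneg _) (by
        rw [← sq_abs]; exact pow_le_one₀ (abs_nonneg _) (hη1 _))
    have h2 := sq_nonneg (η p.1 * vmean t g p.1 - ζ p.1 * vmean t f p.1)
    simp only
    nlinarith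
  rw [integral_add (i3.const_mul 2) (i2.const_mul 2), integral_const_mul, integral_const_mul] at b3
  linarith

/-- The comparison of stray-field energies, for a given square-integrable weak Jacobian. -/
theorem abs_strayEnergy_sub_le (hΩ : IsOpen Ω) (hΩb : Bornology.IsBounded Ω) (ht : 0 < t)
    {M H Hbar : Space → Space} {G : Fin 3 → Space → Space} (hM : Admissible Ω t M)
    (hG : HasWeakJacobianOn (slab Ω (Ioo 0 t)) M G)
    (hG2 : ∀ i, MemLp (G i) 2 (volume.restrict (slab Ω (Ioo 0 t))))
    (hMb : MemLp (thicknessAverage t M) 2 volume)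
    (hH : IsStrayField M H) (hHbar : IsStrayField (thicknessAverage t M) Hbar) :
    |(∫ x, ‖H x‖ ^ 2) - ∫ x, ‖Hbar x‖ ^ 2| ≤
      4000 * (t * (volume (Metric.thickening t (frontier Ω) ∩ Ω)).toReal +
        t ^ 2 * ∫ x in slab Ω (Ioo 0 t), ∑ i, ‖G i x‖ ^ 2) := by
  obtain ⟨η, hη, hηc, hηs, hη1, hηd, hηf⟩ := exists_cutoff hΩ hΩb ht
  let S := Metric.thickening t (frontier Ω)
  have hS : MeasurableSet S := Metric.isOpen_thickening.measurableSet
  let V := t * (volume (S ∩ Ω)).toReal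
  let f : Fin 3 → Plane × ℝ → ℝ := fun j p => M (coords.symm p) j
  let g : Fin 3 → Fin 3 → Plane × ℝ → ℝ := fun j k p => G j (coords.symm p) k
  let a : Fin 3 → Fin 3 → ℝ := fun j k => ∫ p, g j k p ^ 2 ∂film Ω t
  have hf : ∀ j, MemLp (f j) 2 (film Ω t) := memLp_component hM.memLp
  have hg : ∀ j k, MemLp (g j k) 2 (film Ω t) := fun j k =>
    (MemLp.coord (hG2 j) k).comp_measurePreserving (measurePreserving_coords_symm_film_Ioo Ω t)
  have hfb : ∀ j, ∀ᵐ p ∂film Ω t, |f j p| ≤ 1 := ae_abs_component_le hΩ hM.norm_eq_one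
  have ha : ∀ j k, 0 ≤ a j k := fun j k => integral_nonneg fun _ => sq_nonneg _
  have hV : 0 ≤ V := by positivity
  have hI : ∫ x in slab Ω (Ioo 0 t), ∑ i, ‖G i x‖ ^ 2 = ∑ j, ∑ k, a j k := by
    rw [← (measurePreserving_coords_symm_film_Ioo Ω t).integral_comp
      coords.symm.toHomeomorph.measurableEmbedding]
    simp only [norm_sq_eq_sum]
    rw [integral_finsetSum _ fun j _ => integrable_finsetSum _ fun k _ => (hg j k).integrable_sq]
    exact Finset.sum_congr rfl fun j _ => integral_finsetSum _ fun k _ => (hg j k).integrable_sq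
  have hder : ∀ i j, HasFilmDeriv Ω t (coords (basisVec i)) (f j) (g j i) := fun i j =>
    (hG j).hasFilmDeriv i
  have hvf : ∀ j, MemLp (vmean t (f j)) 2 (volume.restrict Ω) := fun j => memLp_vmean ht (hf j)
  have hηa : ∀ x, |η x| ≤ 1 := fun x => abs_le.2 ⟨by linarith [(hη1 x).1], (hη1 x).2⟩
  -- The pieces of the decomposition.
  let e : Fin 3 → Plane := fun i => inPlane (basisVec i)
  let D : Fin 3 → Plane × ℝ → ℝ := fun j p => f j p - vmean t (f j) p.1
  let F : Fin 3 → Plane × ℝ → ℝ := fun j => vprim t (D j)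
  let N : Fin 3 → Plane × ℝ → ℝ := fun j p => η p.1 * vmean t (f j) p.1
  let R : Fin 3 → Plane × ℝ → ℝ := fun j p => (1 - η p.1) * vmean t (f j) p.1
  let A : Fin 3 → Fin 3 → Plane × ℝ → ℝ := fun i j p =>
    η p.1 * vmean t (g j i) p.1 + fderiv ℝ η p.1 (e i) * vmean t (f j) p.1
  have hD : ∀ j, MemLp (D j) 2 (film Ω t) := fun j => memLp_sub_vmean ht (hf j)
  have hF : ∀ j, MemLp (F j) 2 (film Ω t) := fun j => memLp_vprim ht (hD j)
  have hN' : ∀ j, MemLp (fun x => η x * vmean t (f j) x) 2 (volume.restrict Ω) := fun j =>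
    memLp_bdd_mul (hvf j) hη.continuous.aestronglyMeasurable hηa
  have hN : ∀ j, MemLp (N j) 2 (film Ω t) := fun j => (hN' j).comp_fst (thick t)
  have hR1 : ∀ x, |1 - η x| ≤ 1 := fun x =>
    abs_le.2 ⟨by linarith [(hη1 x).2], by linarith [(hη1 x).1]⟩
  have hR' : ∀ j, MemLp (fun x => (1 - η x) * vmean t (f j) x) 2 (volume.restrict Ω) := fun j =>
    memLp_bdd_mul (hvf j) (continuous_const.sub hη.continuous).aestronglyMeasurable hR1
  have hR : ∀ j, MemLp (R j) 2 (film Ω t) := fun j => (hR' j).comp_fst (thick t)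
  have hA : ∀ i j, MemLp (A i j) 2 (film Ω t) ∧
      ∫ p, A i j p ^ 2 ∂film Ω t ≤ 2 * a j i + 2 * ((4 / t) ^ 2 * V) := fun i j => by
    refine integral_cutoff_deriv_sq_le ht (hf j) (hg j i) hη.continuous
      ((hη.continuous_fderiv (by simp)).clm_apply continuous_const) hηa (fun x => ?_) (hfb j) hS
      (fun x hx hxS => ?_) hΩ.measurableSet
    · refine ((fderiv ℝ η x).le_opNorm (e i)).trans ?_
      refine (mul_le_of_le_one_right (norm_nonneg _) ((norm_inPlane_le _).trans ?_)).trans (hηd x)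
      simp [basisVec]
    · rw [(hηf x hx hxS).2]; rfl
  -- The balancing length is the thickness, l = t: then both t⁻²∫|F|² and t²∫|A|² have the size of
  -- the right-hand side.
  have main := abs_integral_strayField_sub_le (M := M) (Mb := thicknessAverage t M) (H := H)
    (Hb := Hbar) (l := t)
    (N := fun j => onSpace Ω t (N j)) (R := fun j => onSpace Ω t (R j))
    (D := fun j => onSpace Ω t (D j)) (F := fun j => onSpace Ω t (F j))
    (A := fun i j => onSpace Ω t (A i j)) ht hM.memLp hMb
    (fun j => memLp_onSpace hΩ (hN j)) (fun j => memLp_onSpace hΩ (hR j))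
    (fun j => memLp_onSpace hΩ (hD j)) (fun j => memLp_onSpace hΩ (hF j))
    (fun i j _ => memLp_onSpace hΩ (hA i j).1)
    (fun j => by
      filter_upwards [thicknessAverage_ae_eq hΩ hM.memLp hM.eq_zero j] with x hx
      rw [hx, ← onSpace_add]
      congr 1
      funext p
      simp only [N, R]
      ring)
    (fun j => by
      filter_upwards [thicknessAverage_ae_eq hΩ hM.memLp hM.eq_zero j,
        ae_eq_onSpace hM.eq_zero j] with x hx hx'
      rw [hx, hx', ← onSpace_add]
      congr 1
      funext p
      simp only [D, f]
      ring)
    (fun j φ hφ => integral_fderiv_mul_onSpace hΩ (fun ψ hψ => by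
      rw [coords_basisVec_two]
      exact integral_fderiv_mul_vprim (hD j) ht (ae_integral_sub_vmean ht (hf j)) hψ) hφ)
    (fun i j hi φ hφ => integral_fderiv_mul_onSpace hΩ (fun ψ hψ => by
      have h1 := hder i j
      rw [coords_basisVec hi] at h1 ⊢
      exact h1.integral_cutoff_vmean ht (hf j) (hg j i) hη hηc hηs hψ) hφ)
    (by
      rw [integral_onSpace_mul hΩ]
      exact integral_sub_vmean_mul ht (hf 2) (hN' 2))
    hH hHbar
  simp only [integral_onSpace_sq hΩ] at main
  have bD : ∀ j, ∫ p, D j p ^ 2 ∂film Ω t ≤ t ^ 2 * a j 2 := fun j => by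
    have h1 := hder 2 j
    rw [coords_basisVec_two] at h1
    exact h1.integral_sub_vmean_sq_le hΩ ht (hf j) (hg j 2)
  have bF : ∀ j, ∫ p, F j p ^ 2 ∂film Ω t ≤ t ^ 2 * (t ^ 2 * a j 2) := fun j =>
    (integral_vprim_sq_le ht (hD j)).trans (mul_le_mul_of_nonneg_left (bD j) (sq_nonneg t))
  have bR : ∀ j, ∫ p, R j p ^ 2 ∂film Ω t ≤ V := fun j => by
    have h1 := integral_horizontal_sq_le ht (hR' j) hS (c := 1) (by
      filter_upwards [ae_abs_vmean_le ht (hfb j)] with x hx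
      rw [abs_mul]
      exact mul_le_one₀ (hR1 x) (abs_nonneg _) hx) (by
      filter_upwards [ae_restrict_mem hΩ.measurableSet] with x hx hxS
      rw [(hηf x hx hxS).1, sub_self, zero_mul])
    rwa [one_pow, one_mul] at h1
  refine main.trans ?_
  rw [hI]
  have sF : (t ^ 2)⁻¹ * (∑ j, ∫ p, F j p ^ 2 ∂film Ω t) ≤ ∑ j, t ^ 2 * a j 2 := by
    rw [inv_mul_le_iff₀ (by positivity), Finset.mul_sum]
    exact Finset.sum_le_sum fun j _ => bF j
  have sD := Finset.sum_le_sum fun j (_ : j ∈ Finset.univ) => bD j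
  have sR := Finset.sum_le_sum fun j (_ : j ∈ Finset.univ) => bR j
  -- The gradient bound 4/t enters squared and the factor t² turns it into 16; doubling from the
  -- square of a sum and adding two horizontal directions gives 64.
  have sA : t ^ 2 * ∑ j, ((∫ p, A 0 j p ^ 2 ∂film Ω t) + ∫ p, A 1 j p ^ 2 ∂film Ω t) ≤
      ∑ j : Fin 3, (2 * (t ^ 2 * a j 0) + 2 * (t ^ 2 * a j 1) + 64 * V) := by
    rw [Finset.mul_sum]
    refine Finset.sum_le_sum fun j _ => ?_
    have h1 := add_le_add (hA 0 j).2 (hA 1 j).2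
    have h2 := mul_le_mul_of_nonneg_left h1 (sq_nonneg t)
    refine h2.trans (le_of_eq ?_)
    field_simp
    ring
  have ha' : ∀ j k, 0 ≤ t ^ 2 * a j k := fun j k => mul_nonneg (sq_nonneg t) (ha j k)
  simp only [Fin.sum_univ_three] at *
  change _ ≤ 4000 * (V + _)
  -- The area term collects 3 from R and 18·3·64 from A, in all 3459. The coefficients of t² times
  -- the squared derivatives are 3 for vertical and 36 for horizontal ones, so 4000 covers
  -- everything.
  rw [mul_assoc 18]
  nlinarith [ha' 0 0, ha' 0 1, ha' 0 2, ha' 1 0, ha' 1 1, ha' 1 2, ha' 2 0, ha' 2 1, ha' 2 2]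

end Energy
end

/-! ### The theorem -/

theorem mainTheorem3 :
    ∃ C : ℝ, 0 < C ∧
      ∀ (Ω : Set Plane) (t : ℝ) (M : Space → Space),
        IsOpen Ω → Bornology.IsBounded Ω → 0 < t → Admissible Ω t M →
        (∃ H, IsStrayField M H) ∧
        (∃ H, IsStrayField (thicknessAverage t M) H) ∧
        ∀ (H Hbar : Space → Space) (G : Fin 3 → Space → Space),
          IsStrayField M H →
          IsStrayField (thicknessAverage t M) Hbar →
          HasWeakJacobianOn (slab Ω (Ioo 0 t)) M G →
          |(∫ x, ‖H x‖ ^ 2) - ∫ x, ‖Hbar x‖ ^ 2| ≤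
            C * (t * (volume (Metric.thickening t (frontier Ω) ∩ Ω)).toReal +
              t ^ 2 * ∫ x in slab Ω (Ioo 0 t), ∑ i, ‖G i x‖ ^ 2) := by
  refine ⟨4000, by norm_num, fun Ω t M hΩ hΩb ht hM => ?_⟩
  have : IsFiniteMeasure (volume.restrict Ω) := isFiniteMeasure_restrict.2 hΩb.measure_lt_top.ne
  obtain ⟨-, hE⟩ := exists_isStrayField_of_onSpace hΩ (memLp_component (t := t) hM.memLp)
    (ae_eq_onSpace hM.eq_zero)
  obtain ⟨hMb, hEb⟩ := exists_isStrayField_of_onSpace hΩ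
    (fun j => (memLp_vmean ht (memLp_component hM.memLp j)).comp_fst (thick t))
    (thicknessAverage_ae_eq hΩ hM.memLp hM.eq_zero)
  refine ⟨hE, hEb, fun H Hbar G hH hHbar hG => ?_⟩
  -- The given Jacobian `G` is only known to be locally integrable. It agrees almost everywhere with
  -- the square-integrable one from the H¹ hypothesis, and so inherits its integrability.
  obtain ⟨-, G', hG', hG'2⟩ := hM.memH1
  exact abs_strayEnergy_sub_le hΩ hΩb ht hM hG
    (fun i => (hG'2 i).ae_eq ((hG' i).ae_eq (isOpen_slab hΩ t) (hG i))) hMb hH hHbar
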